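/- Conventions. A continuum is a compact connected metrizable space (the empty space is not connected); a simple closed curve is a subspace homeomorphic to a circle; an arc is a subspace homeomorphic to $[0,1]$, and its endpoints are the images of $0$ and $1$. A dendrite is a locally connected continuum containing no simple closed curve. A local dendrite is a continuum each point of which has a neighborhood that is a dendrite. A quasi-polyhedron is a connected, locally compact Hausdorff space $Q$ that is countable at infinity (a countable union of compact sets) and in which every point has a fundamental system of open neighborhoods $U$ such that the boundary of $U$ is finite and any two distinct points of $U$ are the endpoints of exactly one arc contained in $U$. A simply connected quasi-polyhedron $Q$ has a unique compactification $\widehat{Q}$ that is a simply connected quasi-polyhedron; the points of $\widehat{Q}-Q$ are the endpoints of $Q$. Berkovich's skeleton $\Delta(X)$ of a quasi-polyhedron $X$ is the complement in $X$ of the set of points having an open neighborhood that is a simply connected quasi-polyhedron with exactly one endpoint. Proposition. Let $X$ be a local dendrite. There is a closed subset $\Delta$ of $X$ that is described by each of the following conditions. (i) If $X$ is a dendrite, then $\Delta=\emptyset$; otherwise $\Delta$ is the smallest subcontinuum of $X$ containing all the simple closed curves in $X$. (ii) $\Delta$ is the union of all arcs in $X$ each endpoint of which belongs to a simple closed curve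 in $X$. (iii) If $X$ has more than one point, then $\Delta$ is Berkovich's skeleton $\Delta(X)$. -/

import Mathlib

universe u

/-- A continuum: a compact connected (in particular nonempty) metrizable space. -/
structure IsContinuum (X : Type u) [TopologicalSpace X] : Prop where
  compact : CompactSpace X
  connected : ConnectedSpace X
  metrizable : TopologicalSpace.MetrizableSpace X

/-- A simple closed curve: a subspace homeomorphic to the circle. -/
def IsSimpleClosedCurve {X : Type u} [TopologicalSpace X] (S : Set X) : Prop :=
  Nonempty (Circle ≃ₜ S)

/-- `A` is an arc with endpoints `a` and `b`: the image of the interval `[0,1]` under a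
topological embedding sending `0` to `a` and `1` to `b`. -/
def IsArc {X : Type u} [TopologicalSpace X] (A : Set X) (a b : X) : Prop :=
  ∃ f : unitInterval → X, Topology.IsEmbedding f ∧ f 0 = a ∧ f 1 = b ∧ Set.range f = A

/-- A dendrite: a locally connected continuum containing no simple closed curve. -/
structure IsDendrite (X : Type u) [TopologicalSpace X] : Prop where
  continuum : IsContinuum X
  locallyConnected : LocallyConnectedSpace X
  noCurve : ∀ S : Set X, ¬ IsSimpleClosedCurve S

/-- A local dendrite: a continuum each point of which has a neighborhood that is a dendrite. -/
structure IsLocalDendrite (X : Type u) [TopologicalSpace X] : Prop where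
  continuum : IsContinuum X
  exists_dendrite_nhd : ∀ x : X, ∃ N ∈ nhds x, IsDendrite N

/-- Any two distinct points of `U` are the endpoints of exactly one arc contained in `U`. -/
def UniquelyArcwiseConnected {X : Type u} [TopologicalSpace X] (U : Set X) : Prop :=
  ∀ x ∈ U, ∀ y ∈ U, x ≠ y → ∃! A : Set X, A ⊆ U ∧ IsArc A x y

/-- A quasi-polyhedron: a connected, locally compact Hausdorff space that is countable at
infinity, in which every point has arbitrarily small open neighborhoods that have finite
boundary and are uniquely arcwise connected. -/
structure IsQuasiPolyhedron (X : Type u) [TopologicalSpace X] : Prop where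
  connected : ConnectedSpace X
  hausdorff : T2Space X
  locallyCompact : LocallyCompactSpace X
  exists_small_nhd : ∀ x : X, ∀ V ∈ nhds x, ∃ U : Set X,
    IsOpen U ∧ x ∈ U ∧ U ⊆ V ∧ (frontier U).Finite ∧ UniquelyArcwiseConnected U
  countableAtInfinity : SigmaCompactSpace X

/-- A quasi-polyhedron that is simply connected in the usual sense (path connected with trivial
fundamental group). -/
structure IsSimplyConnectedQuasiPolyhedron (X : Type u) [TopologicalSpace X] : Prop where
  quasiPolyhedron : IsQuasiPolyhedron X
  simplyConnected : SimplyConnectedSpace X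

/-- The map `j : Q → Qhat` exhibits `Qhat` as a compactification of `Q` that is again a simply
connected quasi-polyhedron. For a simply connected quasi-polyhedron `Q` such a compactification
is unique up to unique homeomorphism over `Q`. -/
structure IsEndpointCompactification {Q Qhat : Type u} [TopologicalSpace Q]
    [TopologicalSpace Qhat] (j : Q → Qhat) : Prop where
  compact : CompactSpace Qhat
  simplyConnectedQuasiPolyhedron : IsSimplyConnectedQuasiPolyhedron Qhat
  isDenseEmbedding : IsDenseEmbedding j

/-- The space `Q` has a single endpoint: exactly one point of its simply connected
quasi-polyhedral compactification lies outside `Q`. -/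
def HasSingleEndpoint (Q : Type u) [TopologicalSpace Q] : Prop :=
  ∃ (Qhat : Type u) (_ : TopologicalSpace Qhat) (j : Q → Qhat),
    IsEndpointCompactification j ∧ ∃ e : Qhat, (Set.range j)ᶜ = {e}

/-- Berkovich's skeleton: the complement of the set of points having a simply connected
quasi-polyhedral open neighborhood with a single endpoint. -/
def berkovichSkeleton (X : Type u) [TopologicalSpace X] : Set X :=
  {x | ∃ Q : Set X, IsOpen Q ∧ x ∈ Q ∧ IsSimplyConnectedQuasiPolyhedron Q ∧
    HasSingleEndpoint Q}ᶜ

/-! Take Δ to be the union of arcs in (ii), `curveHull X`, and compare it with the other two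
descriptions. The recurrent tool is a cycle lemma: if the ends of an arc lie in a connected set that
misses a point x of the arc, then a second arc avoiding x joins the ends, and the two together
contain a simple closed curve through x (`IsArc.exists_isSimpleClosedCurve_of_isPreconnected`). It
makes Δ least among subcontinua containing all curves: a point of Δ missing from such a subcontinuum
would itself lie on a curve.

For Δ(X) ⊆ Δ, a point x off Δ lies on a branch: there is a point e such that the component Q of x in
X - {e}, together with e, contains no simple closed curve (`IsLocalDendrite.exists_branch`; any e ≠
x serves if X is a dendrite). Then Q ∪ {e} is a dendrite, Q is a simply connected quasi-polyhedron,
and e is its only endpoint.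

Conversely, let Q be open with a single endpoint e. Collapsing X - Q to e maps X onto the
compactification of Q, and an arc of Δ meeting Q would produce a simple closed curve there. This is
impossible, because such a curve in a compact metrizable simply connected quasi-polyhedron would
give a circle-valued map without a real lift
(`IsSimplyConnectedQuasiPolyhedron.not_isSimpleClosedCurve`). As Δ(X) is closed by its very form, so
is Δ.

The arcs come from two classical theorems, both proved here: a compact metrizable locally connected
space is locally path-connected, and a path between distinct points contains an arc. -/

open Set Filter Topology

/-! ### Local path-connectedness of compact, metrizable, locally connected spaces -/

/-- There is an `R`-chain with exactly `k` steps from `x` to `y`. -/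
def ChainOfLength {X : Type*} (R : X → X → Prop) : ℕ → X → X → Prop
  | 0, x, y => x = y
  | k + 1, x, y => ∃ z, ChainOfLength R k x z ∧ R z y

theorem ChainOfLength.trans {X : Type*} {R : X → X → Prop} {k m : ℕ} {x y z : X}
    (h : ChainOfLength R k x y) (h' : ChainOfLength R m y z) : ChainOfLength R (k + m) x z := by
  induction m generalizing z with
  | zero => cases h'; exact h
  | succ m ih =>
    obtain ⟨w, hw, hwz⟩ := h'
    exact ⟨w, ih hw, hwz⟩

theorem ChainOfLength.mono {X : Type*} {R : X → X → Prop} {k m : ℕ} {x y : X}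
    (h : ChainOfLength R k x y) (hy : R y y) (hkm : k ≤ m) : ChainOfLength R m x y := by
  induction hkm with
  | refl => exact h
  | step _ ih => exact ⟨y, ih, hy⟩

theorem ChainOfLength.exists_seq {X : Type*} {R : X → X → Prop} {k : ℕ} {x y : X}
    (h : ChainOfLength R k x y) :
    ∃ p : ℕ → X, p 0 = x ∧ p k = y ∧ ∀ i < k, R (p i) (p (i + 1)) := by
  induction k generalizing y with
  | zero => cases h; exact ⟨fun _ => x, rfl, rfl, by simp⟩
  | succ k ih =>
    obtain ⟨w, hw, hwz⟩ := h
    obtain ⟨p, h0, hk, hp⟩ := ih hw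
    refine ⟨fun i => if i ≤ k then p i else y, by simp [h0], by simp, fun i hi => ?_⟩
    rcases Nat.lt_succ_iff_lt_or_eq.1 hi with hi' | rfl
    · simpa [hi'.le, hi'] using hp i hi'
    · simpa [hk] using hwz

theorem ChainOfLength.of_reflTransGen {X : Type*} {R : X → X → Prop} {x y : X}
    (h : Relation.ReflTransGen R x y) : ∃ k, ChainOfLength R k x y := by
  induction h with
  | refl => exact ⟨0, rfl⟩
  | tail _ hR ih =>
    obtain ⟨k, hk⟩ := ih
    exact ⟨k + 1, _, hk, hR⟩

/-- Within the members of a finite cover by connected sets, any two points are joined by chains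
for another finite open cover, of a uniform number of steps. -/
theorem exists_uniform_chainOfLength {X : Type*} [TopologicalSpace X] {c c' : Set (Set X)}
    (hc : c.Finite) (hc' : c'.Finite) (hconn : ∀ C ∈ c, IsPreconnected C)
    (hopen : ∀ V ∈ c', IsOpen V) (hcover : ⋃₀ c' = univ) :
    ∃ N : ℕ, 0 < N ∧ ∀ C ∈ c, ∀ x ∈ C, ∀ y ∈ C,
      ChainOfLength (fun u v => u ∈ C ∧ v ∈ C ∧ ∃ V ∈ c', u ∈ V ∧ v ∈ V) N x y := by
  have hex : ∀ x : X, ∃ V ∈ c', x ∈ V := fun x => by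
    have : x ∈ ⋃₀ c' := hcover ▸ mem_univ x
    simpa using this
  have key : ∀ C ∈ c, ∀ V ∈ c', ∀ V' ∈ c', ∀ᶠ N : ℕ in atTop, ∀ x ∈ C ∩ V, ∀ y ∈ C ∩ V',
      ChainOfLength (fun u v => u ∈ C ∧ v ∈ C ∧ ∃ V ∈ c', u ∈ V ∧ v ∈ V) N x y := by
    intro C hC V hV V' hV'
    rcases (C ∩ V).eq_empty_or_nonempty with h | ⟨u, huC, huV⟩
    · simp [h]
    rcases (C ∩ V').eq_empty_or_nonempty with h | ⟨v, hvC, hvV⟩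
    · simp [h]
    have hR : Relation.ReflTransGen (fun u v => u ∈ C ∧ v ∈ C ∧ ∃ V ∈ c', u ∈ V ∧ v ∈ V) u v := by
      refine (hconn C hC).induction₂' (P := fun u v =>
        Relation.ReflTransGen (fun u v => u ∈ C ∧ v ∈ C ∧ ∃ V ∈ c', u ∈ V ∧ v ∈ V) u v)
        (fun x hx => ?_) (fun a b d _ _ _ h1 h2 => h1.trans h2) huC hvC
      obtain ⟨W, hW, hxW⟩ := hex x
      filter_upwards [self_mem_nhdsWithin, mem_nhdsWithin_of_mem_nhds ((hopen W hW).mem_nhds hxW)]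
        with y hy hyW
      exact ⟨.single ⟨hx, hy, W, hW, hxW, hyW⟩, .single ⟨hy, hx, W, hW, hyW, hxW⟩⟩
    obtain ⟨k, hk⟩ := ChainOfLength.of_reflTransGen hR
    filter_upwards [eventually_ge_atTop (1 + k + 1)] with N hN x hx y hy
    have h1 : ChainOfLength (fun u v => u ∈ C ∧ v ∈ C ∧ ∃ V ∈ c', u ∈ V ∧ v ∈ V) 1 x u :=
      ⟨x, rfl, hx.1, huC, V, hV, hx.2, huV⟩
    have h2 : ChainOfLength (fun u v => u ∈ C ∧ v ∈ C ∧ ∃ V ∈ c', u ∈ V ∧ v ∈ V) 1 v y :=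
      ⟨v, rfl, hvC, hy.1, V', hV', hvV, hy.2⟩
    exact ((h1.trans hk).trans h2).mono ⟨hy.1, hy.1, V', hV', hy.2, hy.2⟩ hN
  have key2 : ∀ᶠ N : ℕ in atTop, ∀ C ∈ c, ∀ V ∈ c', ∀ V' ∈ c', ∀ x ∈ C ∩ V, ∀ y ∈ C ∩ V',
      ChainOfLength (fun u v => u ∈ C ∧ v ∈ C ∧ ∃ V ∈ c', u ∈ V ∧ v ∈ V) N x y :=
    (eventually_all_finite hc).2 fun C hC => (eventually_all_finite hc').2 fun V hV =>
      (eventually_all_finite hc').2 fun V' hV' => key C hC V hV V' hV'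
  obtain ⟨N, hN, hN0⟩ := (key2.and (eventually_gt_atTop 0)).exists
  refine ⟨N, hN0, fun C hC x hx y hy => ?_⟩
  obtain ⟨V, hV, hxV⟩ := hex x
  obtain ⟨V', hV', hyV'⟩ := hex y
  exact hN C hC V hV V' hV' x ⟨hx, hxV⟩ y ⟨hy, hyV'⟩

/-- A path obtained by successively refining finite chains. -/
theorem exists_path_of_refine {X : Type*} [MetricSpace X] [CompleteSpace X] {ε : ℝ}
    (E : ℕ → X → X → Prop) (N : ℕ → ℕ) (hN : ∀ n, 0 < N n)
    (hE : ∀ n x y, E n x y → dist x y ≤ ε / 2 / 2 ^ n)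
    (hr : ∀ n x y, E n x y → ∃ p : ℕ → X, p 0 = x ∧ p (N n) = y ∧ ∀ i < N n,
      E (n + 1) (p i) (p (i + 1)) ∧ dist x (p i) ≤ ε / 2 / 2 ^ n)
    {x y : X} (hxy : E 0 x y) (hyy : E 0 y y) :
    ∃ f : ℝ → X, Continuous f ∧ f 0 = x ∧ f 1 = y ∧ ∀ t, dist x (f t) ≤ 2 * ε := by
  have hε : 0 ≤ ε := by
    have := (dist_nonneg).trans (hE 0 _ _ hxy)
    norm_num at this; linarith
  have hr' : ∀ n x y, ∃ p : ℕ → X, E n x y → p 0 = x ∧ p (N n) = y ∧ ∀ i < N n,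
      E (n + 1) (p i) (p (i + 1)) ∧ dist x (p i) ≤ ε / 2 / 2 ^ n := fun n x y => by
    by_cases h : E n x y
    · obtain ⟨p, hp⟩ := hr n x y h
      exact ⟨p, fun _ => hp⟩
    · exact ⟨fun _ => x, fun h' => absurd h' h⟩
  choose P hP using hr'
  -- `q n` is the chain of level `n`; each of its steps becomes `N n` steps at the next level. Level
  -- 0 is x, y, y, ..., continued forever so that no bound on the index is needed; this is where `E
  -- 0 y y` enters.
  let q : ℕ → ℕ → X := fun n => Nat.rec (fun i => if i = 0 then x else y)
    (fun n qn i => P n (qn (i / N n)) (qn (i / N n + 1)) (i % N n)) n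
  have q0 : ∀ i, q 0 i = if i = 0 then x else y := fun i => rfl
  have qs : ∀ n i, q (n + 1) i = P n (q n (i / N n)) (q n (i / N n + 1)) (i % N n) :=
    fun n i => rfl
  have hq : ∀ n i, E n (q n i) (q n (i + 1)) := by
    intro n
    induction n with
    | zero =>
      intro i
      rcases Nat.eq_zero_or_pos i with rfl | hi
      · simpa [q0] using hxy
      · simpa [q0, hi.ne'] using hyy
    | succ n ih =>
      intro i
      obtain ⟨h0, h1, h2⟩ := hP n _ _ (ih (i / N n))
      have hlt := Nat.mod_lt i (hN n)
      have := (h2 _ hlt).1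
      rw [qs, qs]
      rcases Nat.lt_or_ge (i % N n + 1) (N n) with h | h
      · have e1 : (i + 1) / N n = i / N n := by
          have := Nat.div_add_mod i (N n)
          calc (i + 1) / N n = (i % N n + 1 + N n * (i / N n)) / N n := by congr 1; linarith
            _ = i / N n := by rw [Nat.add_mul_div_left _ _ (hN n), Nat.div_eq_of_lt h, zero_add]
        have e2 : (i + 1) % N n = i % N n + 1 := by
          have a := Nat.div_add_mod i (N n)
          have b := Nat.div_add_mod (i + 1) (N n)
          rw [e1] at b; omega
        rwa [e1, e2]
      · have e : i % N n + 1 = N n := by omega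
        have a := Nat.div_add_mod i (N n)
        have e0 : i + 1 = N n * (i / N n + 1) := by rw [Nat.mul_add]; omega
        have e1 : (i + 1) / N n = i / N n + 1 := by
          rw [e0, Nat.mul_div_cancel_left _ (hN n)]
        have e2 : (i + 1) % N n = 0 := by rw [e0]; simp
        rw [e1, e2, (hP n _ _ (ih (i / N n + 1))).1]
        rwa [e, h1] at this
  let M : ℕ → ℕ := fun n => ∏ k ∈ Finset.range n, N k
  have M0 : M 0 = 1 := by simp [M]
  have Ms : ∀ n, M (n + 1) = M n * N n := fun n => Finset.prod_range_succ _ _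
  have Mpos : ∀ n, 0 < M n := fun n => Finset.prod_pos fun k _ => hN k
  have hq0 : ∀ n, q n 0 = x := by
    intro n
    induction n with
    | zero => simp [q0]
    | succ n ih => rw [qs, Nat.zero_div, Nat.zero_mod, (hP n _ _ (hq n 0)).1, ih]
  have hq1 : ∀ n, q n (M n) = y := by
    intro n
    induction n with
    | zero => simp [q0, M0]
    | succ n ih =>
      rw [qs, Ms, Nat.mul_div_cancel _ (hN n), Nat.mul_mod_left, (hP n _ _ (hq n _)).1, ih]
  -- Level `n` cuts [0,1] into `M n` equal pieces. The floors at consecutive levels are compatible,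
  -- so `f (n + 1) t` lies in the refinement of the step that starts at `f n t`, and the `f n`
  -- converge uniformly.
  let f : ℕ → ℝ → X := fun n t => q n ⌊(M n : ℝ) * t⌋₊
  have hf : ∀ t n, dist (f n t) (f (n + 1) t) ≤ ε / 2 / 2 ^ n := by
    intro t n
    have e : ⌊(M (n + 1) : ℝ) * t⌋₊ / N n = ⌊(M n : ℝ) * t⌋₊ := by
      rw [← Nat.floor_div_natCast, Ms]
      congr 1
      have := (hN n).ne'
      push_cast
      field_simp
    have := ((hP n _ _ (hq n ⌊(M n : ℝ) * t⌋₊)).2.2 _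
      (Nat.mod_lt ⌊(M (n + 1) : ℝ) * t⌋₊ (hN n))).2
    simpa only [f, qs, e] using this
  have hlim : ∀ t, ∃ a, Tendsto (fun n => f n t) atTop (𝓝 a) := fun t =>
    cauchySeq_tendsto_of_complete (cauchySeq_of_le_geometric_two (hf t))
  choose F hF using hlim
  have hFf : ∀ n t, dist (f n t) (F t) ≤ ε / 2 ^ n := fun n t =>
    dist_le_of_le_geometric_two_of_tendsto (hf t) (hF t) n
  refine ⟨F, ?_, ?_, ?_, fun t => ?_⟩
  · rw [Metric.continuous_iff]
    intro t η hη
    obtain ⟨n, hn⟩ : ∃ n : ℕ, ε / 2 ^ n < η / 3 := by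
      have : Tendsto (fun n : ℕ => ε / 2 ^ n) atTop (𝓝 0) :=
        tendsto_const_nhds.div_atTop (tendsto_pow_atTop_atTop_of_one_lt one_lt_two)
      exact (this.eventually (gt_mem_nhds (by positivity))).exists
    have hstep : ∀ i j : ℕ, i ≤ j → j ≤ i + 1 → dist (q n i) (q n j) ≤ ε / 2 ^ n := by
      intro i j h1 h2
      obtain rfl | rfl : j = i ∨ j = i + 1 := by omega
      · simp; positivity
      · refine (hE n _ _ (hq n i)).trans ?_
        gcongr
        linarith
    have hM : (0 : ℝ) < M n := by exact_mod_cast Mpos n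
    have hfloor : ∀ a b : ℝ, a ≤ b → b < a + 1 → ⌊a⌋₊ ≤ ⌊b⌋₊ ∧ ⌊b⌋₊ ≤ ⌊a⌋₊ + 1 := by
      intro a b h1 h2
      refine ⟨Nat.floor_mono h1, ?_⟩
      rcases le_or_gt 0 a with h | h
      · exact (Nat.floor_mono h2.le).trans (Nat.floor_add_one h).le
      · have : ⌊b⌋₊ < 1 := by rw [Nat.floor_lt' one_ne_zero]; push_cast; linarith
        omega
    -- Parameters closer than `1 / M n` have floors differing by at most one, hence lie at most one
    -- chain step apart.
    refine ⟨1 / M n, by positivity, fun s hs => ?_⟩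
    have hs' : |(M n : ℝ) * s - M n * t| < 1 := by
      rw [← mul_sub, abs_mul, abs_of_pos hM]
      rw [Real.dist_eq, lt_div_iff₀ hM] at hs
      linarith
    have hfs : dist (f n s) (f n t) ≤ ε / 2 ^ n := by
      rw [abs_lt] at hs'
      rcases le_total ((M n : ℝ) * s) (M n * t) with h | h
      · exact hstep _ _ (hfloor _ _ h (by linarith)).1 (hfloor _ _ h (by linarith)).2
      · rw [dist_comm]
        exact hstep _ _ (hfloor _ _ h (by linarith)).1 (hfloor _ _ h (by linarith)).2
    calc dist (F s) (F t) ≤ dist (F s) (f n s) + dist (f n s) (f n t) + dist (f n t) (F t) :=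
          dist_triangle4 _ _ _ _
      _ < η := by
          rw [dist_comm (F s)]
          linarith [hFf n s, hFf n t]
  · refine tendsto_nhds_unique (hF 0) ?_
    simp [f, hq0]
  · refine tendsto_nhds_unique (hF 1) ?_
    simp [f, hq1]
  · have h1 := hFf 0 t
    have h2 : dist x (f 0 t) ≤ ε := by
      simp only [f, q0]
      split_ifs
      · simpa using hε
      · refine (hE 0 _ _ hxy).trans ?_
        norm_num; linarith
    have := dist_triangle x (f 0 t) (F t)
    norm_num at h1
    linarith

theorem exists_finite_connected_cover {X : Type*} [MetricSpace X] [CompactSpace X]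
    [LocallyConnectedSpace X] {r : ℝ} (hr : 0 < r) :
    ∃ c : Set (Set X), c.Finite ∧ ⋃₀ c = univ ∧ ∀ C ∈ c, IsOpen C ∧ IsPreconnected C ∧
      ∀ x ∈ C, ∀ y ∈ C, dist x y ≤ r := by
  let C : X → Set X := fun x => connectedComponentIn (Metric.ball x (r / 2)) x
  have hC : ∀ x, C x ∈ 𝓝 x := fun x =>
    connectedComponentIn_mem_nhds (Metric.ball_mem_nhds x (half_pos hr))
  obtain ⟨t, -, ht⟩ := isCompact_univ.elim_nhds_subcover C fun x _ => hC x
  refine ⟨C '' t, t.finite_toSet.image _, ?_, ?_⟩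
  · rw [sUnion_image]
    exact univ_subset_iff.1 ht
  · rintro _ ⟨x, -, rfl⟩
    refine ⟨Metric.isOpen_ball.connectedComponentIn, isPreconnected_connectedComponentIn, ?_⟩
    intro y hy z hz
    have h1 := connectedComponentIn_subset _ _ hy
    have h2 := connectedComponentIn_subset _ _ hz
    have := dist_triangle_right y z x
    simp only [Metric.mem_ball] at h1 h2
    linarith

/-- A compact, metrizable, locally connected space is locally path-connected. -/
theorem LocallyPathConnectedSpace.of_locallyConnected_compact {X : Type*} [TopologicalSpace X]
    [CompactSpace X] [TopologicalSpace.MetrizableSpace X] [LocallyConnectedSpace X] :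
    LocallyPathConnectedSpace X := by
  let _ := TopologicalSpace.metrizableSpaceMetric X
  rw [locallyPathConnectedSpace_iff_pathComponentIn_mem_nhds]
  intro x U hU hxU
  obtain ⟨δ, hδ, hball⟩ := Metric.isOpen_iff.1 hU x hxU
  -- The constructed path stays within `2 * ε = δ / 2` of `x`.
  set ε := δ / 4 with hε
  have hε0 : 0 < ε := by positivity
  choose c hfin hcov hc using fun n : ℕ =>
    exists_finite_connected_cover (X := X) (r := ε / 2 / 2 ^ n) (by positivity)
  choose N hN hchain using fun n : ℕ => exists_uniform_chainOfLength (hfin n) (hfin (n + 1))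
    (fun C hC => (hc n C hC).2.1) (fun V hV => (hc (n + 1) V hV).1) (hcov (n + 1))
  obtain ⟨C, hC, hxC⟩ : ∃ C ∈ c 0, x ∈ C := by
    have : x ∈ ⋃₀ c 0 := (hcov 0).symm ▸ mem_univ x
    simpa using this
  refine mem_of_superset ((hc 0 C hC).1.mem_nhds hxC) fun y hy => ?_
  obtain ⟨f, hf, h0, h1, hd⟩ := exists_path_of_refine (ε := ε)
    (fun n x y => ∃ C ∈ c n, x ∈ C ∧ y ∈ C) N hN
    (fun n x y ⟨C, hC, hx, hy⟩ => (hc n C hC).2.2 x hx y hy)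
    (fun n x y ⟨C, hC, hx, hy⟩ => by
      obtain ⟨p, hp0, hp1, hp⟩ := (hchain n C hC x hx y hy).exists_seq
      refine ⟨p, hp0, hp1, fun i hi => ⟨(hp i hi).2.2, ?_⟩⟩
      exact (hc n C hC).2.2 x hx _ (hp i hi).1)
    (x := x) (y := y) ⟨C, hC, hxC, hy⟩ ⟨C, hC, hy, hy⟩
  refine ⟨⟨⟨fun t => f t, hf.comp continuous_subtype_val⟩, by simpa using h0, by simpa using h1⟩,
    fun t => hball ?_⟩
  rw [Metric.mem_ball']
  have := hd t
  show dist x (f t) < δ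
  linarith

/-! ### Arcs inside paths -/

/-- The bracket of `r` is `r` itself if `r ∈ C`, and otherwise the gap of `C` around `r`, whose ends
`f` identifies. -/
theorem exists_bracket {X : Type*} {f : ℝ → X} {C : Set ℝ} (hC : IsClosed C)
    (hC01 : C ⊆ Icc 0 1) (h0 : (0 : ℝ) ∈ C) (h1 : (1 : ℝ) ∈ C)
    (hgap : ∀ c ∈ C, ∀ d ∈ C, c < d → Disjoint (Ioo c d) C → f c = f d) {r : ℝ}
    (hr : r ∈ Icc (0 : ℝ) 1) :
    ∃ c ∈ C, ∃ d ∈ C, c ≤ r ∧ r ≤ d ∧ f c = f d ∧ (∀ u ∈ C, r ≤ u → d ≤ u) ∧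
      ∀ u ∈ C, u ≤ r → u ≤ c := by
  have hCc : IsCompact C := isCompact_Icc.of_isClosed_subset hC hC01
  obtain ⟨c, hc⟩ := (hCc.inter_right (isClosed_Iic (a := r))).exists_isGreatest ⟨0, h0, hr.1⟩
  obtain ⟨d, hd⟩ := (hCc.inter_right (isClosed_Ici (a := r))).exists_isLeast ⟨1, h1, hr.2⟩
  refine ⟨c, hc.1.1, d, hd.1.1, hc.1.2, hd.1.2, ?_, fun u hu hru => hd.2 ⟨hu, hru⟩,
    fun u hu hru => hc.2 ⟨hu, hru⟩⟩
  rcases (le_trans hc.1.2 hd.1.2 : c ≤ d).eq_or_lt with h | h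
  · rw [h]
  refine hgap c hc.1.1 d hd.1.1 h (disjoint_left.2 fun u hu huC => ?_)
  rcases le_total u r with hur | hur
  · exact absurd (hc.2 ⟨huC, hur⟩) (not_le.2 hu.1)
  · exact absurd (hd.2 ⟨huC, hur⟩) (not_le.2 hu.2)

/-- A minimal closed set of parameters all of whose gaps are loops of the path `f`. -/
theorem exists_minimal_parameters {X : Type*} [TopologicalSpace X] [T2Space X] {f : ℝ → X}
    (hf : Continuous f) :
    ∃ C : Set ℝ, IsClosed C ∧ C ⊆ Icc 0 1 ∧ 0 ∈ C ∧ 1 ∈ C ∧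
      (∀ c ∈ C, ∀ d ∈ C, c < d → Disjoint (Ioo c d) C → f c = f d) ∧
      ∀ c ∈ C, ∀ d ∈ C, c < d → f c = f d → Disjoint (Ioo c d) C := by
  let 𝒞 : Set (Set ℝ) := {C | IsClosed C ∧ C ⊆ Icc 0 1 ∧ 0 ∈ C ∧ 1 ∈ C ∧
      ∀ c ∈ C, ∀ d ∈ C, c < d → Disjoint (Ioo c d) C → f c = f d}
  obtain ⟨C, hCmin⟩ : ∃ C, Minimal (· ∈ 𝒞) C := by
    refine zorn_superset 𝒞 fun c hc hchain => ?_
    rcases c.eq_empty_or_nonempty with rfl | hne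
    · refine ⟨Icc 0 1, ⟨isClosed_Icc, subset_rfl, by simp, by simp, ?_⟩, by simp⟩
      intro a ha b hb hab hdis
      refine absurd (hdis.notMem_of_mem_left (a := (a + b) / 2) ⟨by linarith, by linarith⟩) ?_
      rw [not_not]
      exact ⟨by linarith [ha.1, hb.1], by linarith [ha.2, hb.2]⟩
    obtain ⟨K₀, hK₀⟩ := hne
    refine ⟨⋂₀ c, ⟨isClosed_sInter fun K hK => (hc hK).1, (sInter_subset_of_mem hK₀).trans
      (hc hK₀).2.1, fun K hK => (hc hK).2.2.1, fun K hK => (hc hK).2.2.2.1, ?_⟩,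
      fun K hK => sInter_subset_of_mem hK⟩
    intro a ha b hb hab hdis
    by_contra hne
    have hU : ∀ᶠ p : ℝ × ℝ in 𝓝 (a, b), f p.1 ≠ f p.2 :=
      (isOpen_ne_fun (hf.comp continuous_fst) (hf.comp continuous_snd)).mem_nhds hne
    obtain ⟨ε, hε, hball⟩ := Metric.eventually_nhds_iff_ball.1 hU
    set η := min (ε / 2) ((b - a) / 4) with hη
    have hη0 : 0 < η := lt_min (by positivity) (by linarith)
    have hη1 : η ≤ ε / 2 := min_le_left _ _
    have hη2 : η ≤ (b - a) / 4 := min_le_right _ _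
    -- A gap of the intersection is, by compactness, almost a gap of some member `K` of the chain.
    -- The ends of the true gap of `K` are close to `a` and `b` and are identified by `f`, against
    -- `f a ≠ f b`.
    obtain ⟨K, hK, hKdis⟩ : ∃ K ∈ c, Disjoint (Icc (a + η) (b - η)) K := by
      by_contra! hcon
      have : (⋂₀ ((fun K => Icc (a + η) (b - η) ∩ K) '' c)).Nonempty := by
        have : Nonempty c := ⟨⟨K₀, hK₀⟩⟩
        rw [sInter_image, biInter_eq_iInter]
        refine IsCompact.nonempty_iInter_of_directed_nonempty_isCompact_isClosed _ ?_ ?_ ?_ ?_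
        · intro K L
          rcases hchain.total K.2 L.2 with h | h
          · exact ⟨K, subset_rfl, inter_subset_inter_right _ h⟩
          · exact ⟨L, inter_subset_inter_right _ h, subset_rfl⟩
        · exact fun K => not_disjoint_iff_nonempty_inter.1 (hcon K K.2)
        · exact fun K => isCompact_Icc.inter_right (hc K.2).1
        · exact fun K => isClosed_Icc.inter (hc K.2).1
      obtain ⟨u, hu⟩ := this
      rw [sInter_image] at hu
      simp only [mem_iInter] at hu
      refine hdis.notMem_of_mem_left (a := u) ?_ (fun K hK => (hu K hK).2)
      have := (hu K₀ hK₀).1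
      exact ⟨by linarith [this.1], by linarith [this.2]⟩
    obtain ⟨hKc, hK01, h0, h1, hgap⟩ := hc hK
    have haK := ha K hK
    have hbK := hb K hK
    obtain ⟨s, hs, t, ht, hsr, hrt, hst, hmin, hmax⟩ := exists_bracket hKc hK01 h0 h1 hgap
      (r := (a + b) / 2) ⟨by linarith [(hK01 haK).1, (hK01 hbK).1],
        by linarith [(hK01 haK).2, (hK01 hbK).2]⟩
    have has := hmax a haK (by linarith)
    have htb := hmin b hbK (by linarith)
    have hs' : s < a + η := by
      by_contra! h
      exact disjoint_left.1 hKdis ⟨h, by linarith⟩ hs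
    have ht' : b - η < t := by
      by_contra! h
      exact disjoint_left.1 hKdis ⟨by linarith, h⟩ ht
    refine hball (s, t) ?_ hst
    rw [Metric.mem_ball, Prod.dist_eq, max_lt_iff, Real.dist_eq, Real.dist_eq, abs_lt, abs_lt]
    exact ⟨⟨by linarith, by linarith⟩, ⟨by linarith, by linarith⟩⟩
  obtain ⟨hC, hC01, h0, h1, hgap⟩ := hCmin.prop
  refine ⟨C, hC, hC01, h0, h1, hgap, fun s hs t ht hst hfst => ?_⟩
  -- Cutting out a loop of `f` preserves the gap condition, so minimality says that it was already
  -- cut out.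
  have hmem : C \ Ioo s t ∈ 𝒞 := by
    refine ⟨hC.sdiff isOpen_Ioo, sdiff_subset.trans hC01,
      ⟨h0, fun h => absurd h.1 (not_lt.2 (hC01 hs).1)⟩,
      ⟨h1, fun h => absurd h.2 (not_lt.2 (hC01 ht).2)⟩, ?_⟩
    intro c hc d hd hcd hdis
    by_cases hdis' : Disjoint (Ioo c d) C
    · exact hgap c hc.1 d hd.1 hcd hdis'
    obtain ⟨r, hr, hrC⟩ := not_disjoint_iff.1 hdis'
    have hrst : r ∈ Ioo s t := by
      by_contra h
      exact disjoint_left.1 hdis hr ⟨hrC, h⟩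
    have hcs : c ≤ s := by
      by_contra! h
      exact hc.2 ⟨h, hr.1.trans hrst.2⟩
    have htd : t ≤ d := by
      by_contra! h
      exact hd.2 ⟨hrst.1.trans hr.2, h⟩
    have hcs' : c = s := by
      refine hcs.antisymm (not_lt.1 fun h => ?_)
      exact hdis.notMem_of_mem_left (a := s) ⟨h, hrst.1.trans hr.2⟩ ⟨hs, fun h' => lt_irrefl _ h'.1⟩
    have htd' : t = d := by
      refine htd.antisymm (not_lt.1 fun h => ?_)
      exact hdis.notMem_of_mem_left (a := t) ⟨hr.1.trans hrst.2, h⟩ ⟨ht, fun h' => lt_irrefl _ h'.2⟩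
    rw [hcs', ← htd', hfst]
  have := hCmin.le_of_le hmem sdiff_subset
  exact disjoint_left.2 fun u hu huC => (this huC).2 hu

theorem IsArc.of_continuousOn {X : Type*} [TopologicalSpace X] [T2Space X] {f : ℝ → X} {c d : ℝ}
    (hcd : c < d) (hf : ContinuousOn f (Icc c d)) (hinj : InjOn f (Icc c d)) :
    IsArc (f '' Icc c d) (f c) (f d) := by
  let e := (iccHomeoI c d hcd).symm
  refine ⟨fun t => f (e t), ?_, ?_, ?_, ?_⟩
  · refine (Continuous.isClosedEmbedding ?_ ?_).isEmbedding
    · exact (continuousOn_iff_continuous_domRestrict.1 hf).comp e.continuous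
    · intro s t h
      exact e.injective (Subtype.ext (hinj (e s).2 (e t).2 h))
  · simp [e]
  · simp [e]
  · ext x
    constructor
    · rintro ⟨t, rfl⟩
      exact ⟨_, (e t).2, rfl⟩
    · rintro ⟨t, ht, rfl⟩
      exact ⟨e.symm ⟨t, ht⟩, by simp⟩

theorem IsArc.exists_param {X : Type*} [TopologicalSpace X] {A : Set X} {a b : X}
    (h : IsArc A a b) : ∃ f : ℝ → X, Continuous f ∧ InjOn f (Icc 0 1) ∧ f 0 = a ∧ f 1 = b ∧
      f '' Icc 0 1 = A := by
  obtain ⟨g, hg, rfl, rfl, rfl⟩ := h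
  refine ⟨fun t => g (projIcc 0 1 zero_le_one t), hg.continuous.comp continuous_projIcc, ?_, ?_,
    ?_, ?_⟩
  · intro s hs t ht hst
    have := hg.injective hst
    rw [projIcc_of_mem _ hs, projIcc_of_mem _ ht] at this
    exact congrArg Subtype.val this
  · show g _ = g _
    congr 1
    exact projIcc_left _
  · show g _ = g _
    congr 1
    exact projIcc_right _
  · ext x
    constructor
    · rintro ⟨t, ht, rfl⟩
      exact ⟨_, rfl⟩
    · rintro ⟨t, rfl⟩
      exact ⟨t, t.2, by simp⟩

/-- The endpoints of a nonconstant path are joined by an arc inside the path. -/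
theorem exists_isArc_of_path {X : Type*} [TopologicalSpace X] [CompactSpace X]
    [TopologicalSpace.MetrizableSpace X] {f : ℝ → X} (hf : Continuous f) (hne : f 0 ≠ f 1) :
    ∃ A ⊆ f '' Icc 0 1, IsArc A (f 0) (f 1) := by
  let _ := TopologicalSpace.metrizableSpaceMetric X
  obtain ⟨C, hC, hC01, h0, h1, hgap, hmin⟩ := exists_minimal_parameters hf
  have hCc : IsCompact C := isCompact_Icc.of_isClosed_subset hC hC01
  -- On `C` the path repeats a value only across a gap, so up to these identifications `f` is
  -- injective. The growing compact sets `L r` supply a strictly monotone parameter for the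
  -- quotient.
  let L : ℝ → Set X := fun r => f '' (C ∩ Iic r)
  have hLne : ∀ r ∈ Icc (0 : ℝ) 1, (L r).Nonempty := fun r hr => ⟨f 0, 0, ⟨h0, hr.1⟩, rfl⟩
  have hLmono : ∀ r r', r ≤ r' → L r ⊆ L r' := fun r r' h =>
    image_mono (inter_subset_inter_right _ (Iic_subset_Iic.2 h))
  have hLcpt : ∀ r, IsCompact (L r) := fun r => (hCc.inter_right isClosed_Iic).image hf
  have hLcont : ∀ p, ContinuousOn (fun r => Metric.infDist p (L r)) (Icc 0 1) := by
    intro p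
    have huc : UniformContinuousOn f (Icc 0 1) :=
      isCompact_Icc.uniformContinuousOn_of_continuous hf.continuousOn
    have key : ∀ ε > 0, ∃ δ > 0, ∀ r ∈ Icc (0 : ℝ) 1, ∀ r' ∈ Icc (0 : ℝ) 1, r ≤ r' → r' - r < δ →
        Metric.infDist p (L r) ≤ Metric.infDist p (L r') + ε := by
      intro ε hε
      obtain ⟨δ, hδ, hfδ⟩ := Metric.uniformContinuousOn_iff.1 huc ε hε
      refine ⟨δ, hδ, fun r hr r' hr' hrr' hlt => ?_⟩
      rw [← sub_le_iff_le_add, Metric.le_infDist (hLne r' hr')]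
      rintro _ ⟨u, ⟨huC, hur'⟩, rfl⟩
      obtain ⟨u', hu'C, hu'r, hd⟩ : ∃ u' ∈ C, u' ≤ r ∧ dist (f u) (f u') ≤ ε := by
        rcases le_total u r with hur | hur
        · exact ⟨u, huC, hur, by simpa using hε.le⟩
        -- The far end `d` of the bracket lies between `r` and `u`, so `f u` is close to `f d`,
        -- which equals `f c` and so belongs to `L r`.
        obtain ⟨c, hc, d, hd, hcr, hrd, hcd, hd', -⟩ := exists_bracket hC hC01 h0 h1 hgap hr
        refine ⟨c, hc, hcr, ?_⟩
        rw [hcd]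
        have := hd' u huC hur
        simp only [mem_Iic] at hur'
        refine (hfδ _ (hC01 huC) _ (hC01 hd) ?_).le
        rw [Real.dist_eq, abs_lt]
        constructor <;> linarith
      have h1 := Metric.infDist_le_dist_of_mem (x := p)
        (show f u' ∈ L r from ⟨u', ⟨hu'C, hu'r⟩, rfl⟩)
      have h2 := dist_triangle p (f u) (f u')
      linarith
    rw [Metric.continuousOn_iff]
    intro r hr ε hε
    obtain ⟨δ, hδ, h⟩ := key (ε / 2) (by positivity)
    refine ⟨δ, hδ, fun r' hr' hd => ?_⟩
    rw [Real.dist_eq, abs_lt] at hd ⊢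
    rcases le_total r r' with hrr | hrr
    · have h3 := h r hr r' hr' hrr (by linarith)
      have h4 := Metric.infDist_le_infDist_of_subset (x := p) (hLmono _ _ hrr) (hLne r hr)
      constructor <;> linarith
    · have h3 := h r' hr' r hr hrr (by linarith)
      have h4 := Metric.infDist_le_infDist_of_subset (x := p) (hLmono _ _ hrr) (hLne r' hr')
      constructor <;> linarith
  have : Nonempty X := ⟨f 0⟩
  let p := TopologicalSpace.denseSeq X
  -- The sum `w` of these weighted distances to a dense sequence is continuous, decreases as `L r`
  -- grows, and drops strictly when `L r` gains a point; hence on `C` it separates parameters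
  -- exactly as `f` does.
  let φ : ℕ → ℝ → ℝ := fun n r => min 1 (Metric.infDist (p n) (L r)) * (1 / 2) ^ n
  have hφ0 : ∀ n r, 0 ≤ φ n r := fun n r =>
    mul_nonneg (le_min zero_le_one Metric.infDist_nonneg) (by positivity)
  have hφ1 : ∀ n r, φ n r ≤ (1 / 2) ^ n := fun n r =>
    mul_le_of_le_one_left (by positivity) (min_le_left _ _)
  have hsum : ∀ r, Summable fun n => φ n r := fun r =>
    Summable.of_nonneg_of_le (fun n => hφ0 n r) (fun n => hφ1 n r) summable_geometric_two
  let w : ℝ → ℝ := fun r => ∑' n, φ n r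
  have hwcont : ContinuousOn w (Icc 0 1) := by
    refine continuousOn_tsum (u := fun n => (1 / 2 : ℝ) ^ n) (fun n => ?_) summable_geometric_two
      fun n r _ => ?_
    · exact (continuousOn_const.inf (hLcont _)).mul continuousOn_const
    · rw [Real.norm_of_nonneg (hφ0 n r)]
      exact hφ1 n r
  have hweq : ∀ s ∈ C, ∀ t ∈ C, s < t → f s = f t → w s = w t := by
    intro s hs t ht hst hfst
    have : L s = L t := by
      refine (hLmono _ _ hst.le).antisymm ?_
      rintro _ ⟨u, ⟨huC, hut⟩, rfl⟩
      rcases le_or_gt u s with hus | hus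
      · exact ⟨u, ⟨huC, hus⟩, rfl⟩
      rcases (show u ≤ t from hut).eq_or_lt with rfl | hut
      · exact ⟨s, ⟨hs, self_mem_Iic⟩, hfst⟩
      · exact absurd huC (disjoint_left.1 (hmin s hs t ht hst hfst) ⟨hus, hut⟩)
    simp only [w, φ, this]
  have hwlt : ∀ s ∈ C, ∀ t ∈ C, s < t → f s ≠ f t → w t < w s := by
    intro s hs t ht hst hfst
    have hnot : f t ∉ L s := by
      rintro ⟨u, ⟨huC, hus⟩, hu⟩
      rcases (show u ≤ s from hus).eq_or_lt with rfl | hus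
      · exact hfst hu
      · exact disjoint_left.1 (hmin u huC t ht (hus.trans hst) hu) ⟨hus, hst⟩ hs
    have hpos : 0 < Metric.infDist (f t) (L s) :=
      ((hLcpt s).isClosed.notMem_iff_infDist_pos (hLne s (hC01 hs))).1 hnot
    set η := Metric.infDist (f t) (L s)
    obtain ⟨n, hn⟩ := (TopologicalSpace.denseRange_denseSeq X).exists_dist_lt (f t)
      (show 0 < min (η / 2) 1 from by positivity)
    refine Summable.tsum_lt_tsum (i := n) (fun k => ?_) ?_ (hsum t) (hsum s)
    · refine mul_le_mul_of_nonneg_right (min_le_min le_rfl ?_) (by positivity)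
      exact Metric.infDist_le_infDist_of_subset (hLmono _ _ hst.le) (hLne s (hC01 hs))
    · refine mul_lt_mul_of_pos_right ?_ (by positivity)
      have e1 : Metric.infDist (p n) (L t) ≤ dist (p n) (f t) :=
        Metric.infDist_le_dist_of_mem ⟨t, ⟨ht, self_mem_Iic⟩, rfl⟩
      have e2 : η ≤ Metric.infDist (p n) (L s) + dist (f t) (p n) :=
        Metric.infDist_le_infDist_add_dist
      rw [lt_min_iff] at hn
      have e3 := hn.1
      have e4 := hn.2
      rw [dist_comm] at e1
      rw [lt_min_iff, min_lt_iff, min_lt_iff]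
      constructor <;> right <;> simp only [p] at * <;> linarith
  have hiff : ∀ s ∈ C, ∀ t ∈ C, (f s = f t ↔ w s = w t) := by
    intro s hs t ht
    rcases lt_trichotomy s t with h | rfl | h
    · refine ⟨hweq s hs t ht h, fun h' => ?_⟩
      by_contra hn
      exact (hwlt s hs t ht h hn).ne' h'
    · simp
    · refine ⟨fun h' => (hweq t ht s hs h h'.symm).symm, fun h' => ?_⟩
      by_contra hn
      exact (hwlt t ht s hs h (Ne.symm hn)).ne h'
  have hanti : AntitoneOn w (Icc 0 1) := by
    intro r hr r' hr' hrr'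
    refine Summable.tsum_le_tsum (fun n => ?_) (hsum r') (hsum r)
    refine mul_le_mul_of_nonneg_right (min_le_min le_rfl ?_) (by positivity)
    exact Metric.infDist_le_infDist_of_subset (hLmono _ _ hrr') (hLne r hr)
  have h01 : w 1 < w 0 := hwlt 0 h0 1 h1 one_pos hne
  -- By monotonicity `w` is constant across each gap, so restricting to `C` loses no value.
  have himg : ∀ v ∈ Icc (w 1) (w 0), ∃ r ∈ C, w r = v := by
    intro v hv
    obtain ⟨r, hr, rfl⟩ := intermediate_value_Icc' zero_le_one hwcont hv
    obtain ⟨c, hc, d, hd, hcr, hrd, hcd, -, -⟩ := exists_bracket hC hC01 h0 h1 hgap hr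
    refine ⟨c, hc, le_antisymm ?_ (hanti (hC01 hc) hr hcr)⟩
    rw [(hiff c hc d hd).1 hcd]
    exact hanti hr (hC01 hd) hrd
  choose! ρ hρC hρ using himg
  have hwC : ∀ r ∈ C, w r ∈ Icc (w 1) (w 0) := fun r hr =>
    ⟨hanti (hC01 hr) (by simp) (hC01 hr).2, hanti (by simp) (hC01 hr) (hC01 hr).1⟩
  have hfρ : ∀ r ∈ C, f (ρ (w r)) = f r := fun r hr =>
    (hiff _ (hρC _ (hwC r hr)) r hr).2 (hρ _ (hwC r hr))
  have hFcont : ContinuousOn (fun v => f (ρ v)) (Icc (w 1) (w 0)) := by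
    rw [continuousOn_iff_isClosed]
    intro K hK
    refine ⟨w '' (C ∩ f ⁻¹' K), ?_, ?_⟩
    · exact ((hCc.inter_right (hK.preimage hf)).image_of_continuousOn
        (hwcont.mono (inter_subset_left.trans hC01))).isClosed
    · ext v
      constructor
      · rintro ⟨hvK, hv⟩
        exact ⟨⟨ρ v, ⟨hρC v hv, hvK⟩, hρ v hv⟩, hv⟩
      · rintro ⟨⟨r, ⟨hr, hrK⟩, rfl⟩, hv⟩
        refine ⟨?_, hv⟩
        show f (ρ (w r)) ∈ K
        rw [hfρ r hr]
        exact hrK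
  have hFinj : InjOn (fun v => f (ρ v)) (Icc (w 1) (w 0)) := by
    intro v hv v' hv' h
    have := (hiff _ (hρC v hv) _ (hρC v' hv')).1 h
    rwa [hρ v hv, hρ v' hv'] at this
  -- The sign reverses the decreasing parameter `w`, so that the arc starts at `f 0`.
  have harc := IsArc.of_continuousOn (f := fun v => f (ρ (-v))) (c := -w 0) (d := -w 1)
    (by linarith)
    (hFcont.comp continuous_neg.continuousOn fun v hv => ⟨by linarith [hv.2], by linarith [hv.1]⟩)
    (fun v hv v' hv' h => neg_injective
      (hFinj ⟨by linarith [hv.2], by linarith [hv.1]⟩ ⟨by linarith [hv'.2], by linarith [hv'.1]⟩ h))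
  simp only [neg_neg, hfρ 0 h0, hfρ 1 h1] at harc
  refine ⟨_, ?_, harc⟩
  rintro _ ⟨v, hv, rfl⟩
  exact ⟨_, hC01 (hρC (-v) ⟨by linarith [hv.2], by linarith [hv.1]⟩), rfl⟩

/-- Two points of a connected open set in a compact, metrizable, locally connected space are
joined by an arc in that set. -/
theorem exists_isArc_of_isOpen {X : Type*} [TopologicalSpace X] [CompactSpace X]
    [TopologicalSpace.MetrizableSpace X] [LocallyConnectedSpace X] {U : Set X} (hU : IsOpen U)
    (hconn : IsPreconnected U) {x y : X} (hx : x ∈ U) (hy : y ∈ U) (hxy : x ≠ y) :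
    ∃ A ⊆ U, IsArc A x y := by
  have := LocallyPathConnectedSpace.of_locallyConnected_compact (X := X)
  obtain ⟨γ, hγ⟩ := (hU.isConnected_iff_isPathConnected.1 ⟨⟨x, hx⟩, hconn⟩).joinedIn x hx y hy
  obtain ⟨A, hA, hA'⟩ := exists_isArc_of_path (f := γ.extend) γ.continuous_extend (by simpa)
  simp only [Path.extend_zero, Path.extend_one] at hA'
  refine ⟨A, hA.trans ?_, hA'⟩
  rintro _ ⟨t, ht, rfl⟩
  rw [γ.extend_apply ht]
  exact hγ _

/-! ### Arcs and simple closed curves -/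

theorem injOn_of_eq_add_int {Y : Type*} {g : ℝ → Y} (hg : ∀ s t, g s = g t → ∃ m : ℤ, s = t + m) (c : ℝ) :
    InjOn g (Ico c (c + 1)) := by
  intro s hs t ht hst
  obtain ⟨m, hm⟩ := hg s t hst
  have h1 : (m : ℝ) < 1 := by linarith [hs.2, ht.1]
  have h2 : (-1 : ℝ) < m := by linarith [hs.1, ht.2]
  have h1' : m < 1 := by exact_mod_cast h1
  have h2' : -1 < m := by exact_mod_cast h2
  have : m = 0 := by omega
  simpa [this] using hm

section Arcs

variable {X : Type*} [TopologicalSpace X]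

theorem IsArc.left_mem {A : Set X} {a b : X} (h : IsArc A a b) : a ∈ A := by
  obtain ⟨f, -, rfl, rfl, rfl⟩ := h
  exact mem_range_self _

theorem IsArc.right_mem {A : Set X} {a b : X} (h : IsArc A a b) : b ∈ A := by
  obtain ⟨f, -, rfl, rfl, rfl⟩ := h
  exact mem_range_self _

theorem IsArc.ne {A : Set X} {a b : X} (h : IsArc A a b) : a ≠ b := by
  obtain ⟨f, hf, rfl, rfl, rfl⟩ := h
  exact hf.injective.ne zero_ne_one

theorem IsArc.isCompact {A : Set X} {a b : X} (h : IsArc A a b) : IsCompact A := by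
  obtain ⟨f, hf, rfl, rfl, rfl⟩ := h
  exact isCompact_range hf.continuous

theorem IsArc.isPreconnected {A : Set X} {a b : X} (h : IsArc A a b) : IsPreconnected A := by
  obtain ⟨f, hf, rfl, rfl, rfl⟩ := h
  exact isPreconnected_range hf.continuous

theorem IsArc.symm {A : Set X} {a b : X} (h : IsArc A a b) : IsArc A b a := by
  obtain ⟨f, hf, rfl, rfl, rfl⟩ := h
  refine ⟨f ∘ unitInterval.symm, hf.comp unitInterval.symmHomeomorph.isEmbedding, by simp,
    by simp, ?_⟩
  exact unitInterval.symmHomeomorph.surjective.range_comp f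

theorem IsArc.image {Y : Type*} [TopologicalSpace Y] {A : Set X} {a b : X} (h : IsArc A a b)
    {g : X → Y} (hg : IsEmbedding g) : IsArc (g '' A) (g a) (g b) := by
  obtain ⟨f, hf, rfl, rfl, rfl⟩ := h
  exact ⟨g ∘ f, hg.comp hf, rfl, rfl, range_comp g f⟩

theorem IsArc.preimage {Y : Type*} [TopologicalSpace Y] {g : X → Y} (hg : IsEmbedding g)
    {A : Set Y} {a b : X} (h : IsArc A (g a) (g b)) (hA : A ⊆ range g) :
    IsArc (g ⁻¹' A) a b := by
  obtain ⟨f, hf, h0, h1, rfl⟩ := h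
  choose k hk using fun t => hA (mem_range_self t)
  have hgk : g ∘ k = f := funext hk
  refine ⟨k, ?_, hg.injective ((hk 0).trans h0), hg.injective ((hk 1).trans h1), ?_⟩
  · exact hg.of_comp_iff.1 (hgk ▸ hf)
  · rw [← hgk, range_comp, preimage_image_eq _ hg.injective]

theorem IsSimpleClosedCurve.image {Y : Type*} [TopologicalSpace Y] {S : Set X}
    (h : IsSimpleClosedCurve S) {g : X → Y} (hg : IsEmbedding g) :
    IsSimpleClosedCurve (g '' S) := by
  obtain ⟨e⟩ := h
  exact ⟨e.trans (hg.homeomorphImage S)⟩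

theorem IsSimpleClosedCurve.preimage {Y : Type*} [TopologicalSpace Y] {S : Set Y}
    (h : IsSimpleClosedCurve S) {g : X → Y} (hg : IsEmbedding g) (hS : S ⊆ range g) :
    IsSimpleClosedCurve (g ⁻¹' S) := by
  obtain ⟨e⟩ := h
  have := (hg.homeomorphImage (g ⁻¹' S)).symm
  rw [image_preimage_eq_of_subset hS] at this
  exact ⟨e.trans this⟩

theorem IsSimpleClosedCurve.isPreconnected {S : Set X} (h : IsSimpleClosedCurve S) :
    IsPreconnected S := by
  obtain ⟨e⟩ := h
  have hc : PreconnectedSpace Circle := by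
    have := isPreconnected_range (AddCircle.homeomorphCircle (T := (1 : ℝ)) one_ne_zero).continuous
    rw [(AddCircle.homeomorphCircle (T := (1 : ℝ)) one_ne_zero).surjective.range_eq] at this
    exact ⟨this⟩
  have := isPreconnected_range (continuous_subtype_val.comp e.continuous)
  rwa [e.surjective.range_comp, Subtype.range_coe] at this

theorem IsArc.isClosed [T2Space X] {A : Set X} {a b : X} (h : IsArc A a b) : IsClosed A := h.isCompact.isClosed

theorem isArc_image_uIcc [T2Space X] {f : ℝ → X} (hf : Continuous f) {c d : ℝ} (hinj : InjOn f (Icc c d))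
    {s t : ℝ} (hs : s ∈ Icc c d) (ht : t ∈ Icc c d) (hst : s ≠ t) :
    IsArc (f '' uIcc s t) (f s) (f t) := by
  rcases hst.lt_or_gt with h | h
  · rw [uIcc_of_le h.le]
    exact .of_continuousOn h hf.continuousOn (hinj.mono (Icc_subset_Icc hs.1 ht.2))
  · rw [uIcc_of_ge h.le]
    exact (IsArc.of_continuousOn h hf.continuousOn (hinj.mono (Icc_subset_Icc ht.1 hs.2))).symm

theorem IsArc.exists_subarc_of_mem [T2Space X] {A : Set X} {a b p q : X} (h : IsArc A a b) (hp : p ∈ A)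
    (hq : q ∈ A) (hpq : p ≠ q) : ∃ B ⊆ A, IsArc B p q := by
  obtain ⟨f, hf, hinj, -, -, rfl⟩ := h.exists_param
  obtain ⟨s, hs, rfl⟩ := hp
  obtain ⟨t, ht, rfl⟩ := hq
  exact ⟨_, image_mono (uIcc_subset_Icc hs ht),
    isArc_image_uIcc hf hinj hs ht (fun h => hpq (h ▸ rfl))⟩

/-- A point of an arc outside a closed set containing the endpoints lies in a subarc that meets
the closed set only in its endpoints. -/
theorem IsArc.exists_subarc [T2Space X] {A K : Set X} {a b x : X} (h : IsArc A a b) (hK : IsClosed K)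
    (ha : a ∈ K) (hb : b ∈ K) (hx : x ∈ A) (hxK : x ∉ K) :
    ∃ A' ⊆ A, ∃ a' ∈ K, ∃ b' ∈ K, IsArc A' a' b' ∧ x ∈ A' ∧ A' ∩ K ⊆ {a', b'} := by
  obtain ⟨f, hf, hinj, rfl, rfl, rfl⟩ := h.exists_param
  obtain ⟨t, ht, rfl⟩ := hx
  obtain ⟨s₁, hs₁⟩ := ((isCompact_Icc (a := 0) (b := t)).inter_right
    (hK.preimage hf)).exists_isGreatest ⟨0, ⟨le_rfl, ht.1⟩, ha⟩
  obtain ⟨s₂, hs₂⟩ := ((isCompact_Icc (a := t) (b := 1)).inter_right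
    (hK.preimage hf)).exists_isLeast ⟨1, ⟨ht.2, le_rfl⟩, hb⟩
  have h1 : s₁ < t := hs₁.1.1.2.lt_of_ne fun h => hxK (h ▸ hs₁.1.2)
  have h2 : t < s₂ := hs₂.1.1.1.lt_of_ne fun h => hxK (h ▸ hs₂.1.2)
  have hsub : Icc s₁ s₂ ⊆ Icc 0 1 := Icc_subset_Icc hs₁.1.1.1 hs₂.1.1.2
  refine ⟨f '' Icc s₁ s₂, image_mono hsub, f s₁, hs₁.1.2, f s₂, hs₂.1.2,
    .of_continuousOn (h1.trans h2) hf.continuousOn (hinj.mono hsub), ⟨t, ⟨h1.le, h2.le⟩, rfl⟩, ?_⟩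
  rintro _ ⟨⟨u, hu, rfl⟩, huK⟩
  rcases le_total u t with hut | hut
  · have := hs₁.2 ⟨⟨hs₁.1.1.1.trans hu.1, hut⟩, huK⟩
    rw [this.antisymm hu.1]
    simp
  · have := hs₂.2 ⟨⟨hut, hu.2.trans hs₂.1.1.2⟩, huK⟩
    rw [this.antisymm' hu.2]
    simp

theorem isSimpleClosedCurve_of_loop [T2Space X] {f : ℝ → X} (hf : ContinuousOn f (Icc 0 1))
    (h01 : f 0 = f 1) (hinj : InjOn f (Ico 0 1)) : IsSimpleClosedCurve (f '' Icc 0 1) := by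
  let F : AddCircle (1 : ℝ) → X := AddCircle.liftIco 1 0 f
  have hF : Continuous F := AddCircle.liftIco_continuous (by simpa using h01) (by simpa using hf)
  have hval : ∀ t ∈ Ico (0 : ℝ) 1, F t = f t := fun t ht =>
    AddCircle.liftIco_coe_apply (by simpa using ht)
  have hrep : ∀ z : AddCircle (1 : ℝ), ∃ t ∈ Ico (0 : ℝ) 1, (t : AddCircle (1 : ℝ)) = z := by
    intro z
    have := (AddCircle.equivIco (1 : ℝ) 0 z).2
    exact ⟨_, ⟨this.1, by simpa using this.2⟩, AddCircle.coe_equivIco⟩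
  have hFinj : F.Injective := by
    intro z z' h
    obtain ⟨t, ht, rfl⟩ := hrep z
    obtain ⟨t', ht', rfl⟩ := hrep z'
    rw [hval t ht, hval t' ht'] at h
    rw [hinj ht ht' h]
  have hrange : range F = f '' Icc 0 1 := by
    ext x
    constructor
    · rintro ⟨z, rfl⟩
      obtain ⟨t, ht, rfl⟩ := hrep z
      exact ⟨t, Ico_subset_Icc_self ht, (hval t ht).symm⟩
    · rintro ⟨t, ht, rfl⟩
      rcases ht.2.eq_or_lt with rfl | h
      · exact ⟨(0 : ℝ), by rw [hval 0 (by simp), h01]⟩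
      · exact ⟨t, hval t ⟨ht.1, h⟩⟩
  rw [← hrange]
  exact ⟨(AddCircle.homeomorphCircle (T := (1 : ℝ)) one_ne_zero).symm.trans
    (hF.isClosedEmbedding hFinj).isEmbedding.toHomeomorph⟩

/-- Unwinding the circle to the line from a prescribed base point makes subarcs of the curve images
of intervals. -/
theorem IsSimpleClosedCurve.exists_param {S : Set X} (h : IsSimpleClosedCurve S) {p : X}
    (hp : p ∈ S) : ∃ g : ℝ → X, Continuous g ∧ g 0 = p ∧ g 1 = p ∧
      (∀ s t, g s = g t → ∃ m : ℤ, s = t + m) ∧ g '' Ico 0 1 = S ∧ ∀ t, g t ∈ S := by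
  obtain ⟨e⟩ := h
  let θ := Complex.arg (e.symm ⟨p, hp⟩ : Circle)
  have hθ : Circle.exp θ = e.symm ⟨p, hp⟩ := Circle.exp_arg _
  let g : ℝ → X := fun t => e (Circle.exp (2 * Real.pi * t + θ))
  have hπ := Real.pi_pos
  refine ⟨g, ?_, ?_, ?_, ?_, ?_, fun t => (e _).2⟩
  · exact continuous_subtype_val.comp (e.continuous.comp
      (Circle.exp.continuous.comp (by fun_prop)))
  · simp [g, hθ]
  · have : (2 * Real.pi * 1 + θ) = θ + 2 * Real.pi := by ring
    simp only [g, this, Circle.periodic_exp θ, hθ, e.apply_symm_apply]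
  · intro s t h
    have := e.injective (Subtype.ext h)
    obtain ⟨m, hm⟩ := Circle.exp_eq_exp.1 this
    refine ⟨m, ?_⟩
    have : 2 * Real.pi * (s - (t + m)) = 0 := by linarith
    rcases mul_eq_zero.1 this with h | h <;> linarith
  · apply subset_antisymm
    · rintro _ ⟨t, -, rfl⟩
      exact (e _).2
    · intro x hx
      let α := Complex.arg (e.symm ⟨x, hx⟩ : Circle)
      have hα : Circle.exp α = e.symm ⟨x, hx⟩ := Circle.exp_arg _
      refine ⟨Int.fract ((α - θ) / (2 * Real.pi)), ⟨Int.fract_nonneg _, Int.fract_lt_one _⟩, ?_⟩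
      have : Circle.exp (2 * Real.pi * Int.fract ((α - θ) / (2 * Real.pi)) + θ) =
          Circle.exp α := by
        refine Circle.exp_eq_exp.2 ⟨-⌊(α - θ) / (2 * Real.pi)⌋, ?_⟩
        rw [Int.fract]
        push_cast
        field_simp
        ring
      simp only [g, this, hα, e.apply_symm_apply]

/-- Through any point of a simple closed curve there runs an arc of the curve with any two
prescribed endpoints. -/
theorem IsSimpleClosedCurve.exists_isArc [T2Space X] {S : Set X} (h : IsSimpleClosedCurve S) {p q c : X}
    (hp : p ∈ S) (hq : q ∈ S) (hc : c ∈ S) (hpq : p ≠ q) :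
    ∃ A ⊆ S, IsArc A p q ∧ c ∈ A := by
  obtain ⟨g, hg, h0, h1, hm, hS, hgS⟩ := h.exists_param hp
  obtain ⟨u, hu, rfl⟩ : q ∈ g '' Ico 0 1 := hS ▸ hq
  obtain ⟨v, hv, rfl⟩ : c ∈ g '' Ico 0 1 := hS ▸ hc
  have hu0 : 0 < u := hu.1.lt_of_ne fun h => hpq (by rw [← h0, h])
  rcases le_total v u with h | h
  · refine ⟨g '' Icc 0 u, image_subset_iff.2 fun t _ => hgS t, ?_, ⟨v, ⟨hv.1, h⟩, rfl⟩⟩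
    rw [← h0]
    exact .of_continuousOn hu0 hg.continuousOn ((injOn_of_eq_add_int hm 0).mono
      (Icc_subset_Ico_right (by linarith [hu.2])))
  · refine ⟨g '' Icc u 1, image_subset_iff.2 fun t _ => hgS t, ?_, ⟨v, ⟨h, hv.2.le⟩, rfl⟩⟩
    rw [← h1]
    exact (IsArc.of_continuousOn hu.2 hg.continuousOn ((injOn_of_eq_add_int hm u).mono
      (Icc_subset_Ico_right (by linarith)))).symm

theorem IsSimpleClosedCurve.exists_ne {S : Set X} (h : IsSimpleClosedCurve S) {p : X}
    (hp : p ∈ S) : ∃ q ∈ S, p ≠ q := by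
  obtain ⟨g, hg, h0, h1, hm, hS, hgS⟩ := h.exists_param hp
  refine ⟨g (1 / 2), hgS _, fun h => ?_⟩
  have := injOn_of_eq_add_int hm 0 (show (0 : ℝ) ∈ _ by simp) (show (1 / 2 : ℝ) ∈ _ by norm_num)
    (h0.trans h)
  norm_num at this

theorem IsSimpleClosedCurve.nonempty {S : Set X} (h : IsSimpleClosedCurve S) : S.Nonempty := by
  obtain ⟨e⟩ := h
  exact ⟨_, (e 1).2⟩

/-- Two arcs with the same endpoints that are otherwise disjoint form a simple closed curve. -/
theorem IsArc.isSimpleClosedCurve_union [T2Space X] {A B : Set X} {a b : X} (hA : IsArc A a b)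
    (hB : IsArc B a b) (hAB : A ∩ B ⊆ {a, b}) : IsSimpleClosedCurve (A ∪ B) := by
  obtain ⟨f, hf, hfi, hf0, hf1, rfl⟩ := hA.exists_param
  obtain ⟨g, hg, hgi, hg0, hg1, rfl⟩ := hB.exists_param
  -- Traverse the first arc at double speed, then the second one backwards.
  let h : ℝ → X := fun t => if t ≤ 1 / 2 then f (2 * t) else g (2 - 2 * t)
  have hcont : Continuous h := by
    refine Continuous.if_le (by fun_prop) (by fun_prop) continuous_id continuous_const ?_
    rintro t rfl
    norm_num [hf1, hg1]
  have hle : ∀ t, t ≤ 1 / 2 → h t = f (2 * t) := fun t ht => if_pos ht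
  have hgt : ∀ t, 1 / 2 < t → h t = g (2 - 2 * t) := fun t ht => if_neg (not_le.2 ht)
  have himg : h '' Icc 0 1 = f '' Icc 0 1 ∪ g '' Icc 0 1 := by
    apply subset_antisymm
    · rintro _ ⟨t, ht, rfl⟩
      rcases le_or_gt t (1 / 2) with h' | h'
      · rw [hle t h']
        exact .inl ⟨_, ⟨by linarith [ht.1], by linarith⟩, rfl⟩
      · rw [hgt t h']
        exact .inr ⟨_, ⟨by linarith [ht.2], by linarith⟩, rfl⟩
    · rintro _ (⟨t, ht, rfl⟩ | ⟨t, ht, rfl⟩)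
      · refine ⟨t / 2, ⟨by linarith [ht.1], by linarith [ht.2]⟩, ?_⟩
        rw [hle _ (by linarith [ht.2])]
        ring_nf
      · rcases ht.2.eq_or_lt with rfl | h'
        · refine ⟨1 / 2, by norm_num, ?_⟩
          rw [hle _ le_rfl, hg1]
          norm_num [hf1]
        · refine ⟨1 - t / 2, ⟨by linarith [ht.1], by linarith [ht.1]⟩, ?_⟩
          rw [hgt _ (by linarith [ht.2])]
          ring_nf
  rw [← himg]
  have hmix : ∀ s t : ℝ, 0 ≤ s → s ≤ 1 / 2 → 1 / 2 < t → t < 1 → h s ≠ h t := by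
    intro s t hs hs' ht ht' heq
    rw [hle s hs', hgt t ht] at heq
    have hmem : f (2 * s) ∈ ({a, b} : Set X) :=
      hAB ⟨⟨_, ⟨by linarith, by linarith⟩, rfl⟩, heq ▸ ⟨_, ⟨by linarith, by linarith⟩, rfl⟩⟩
    rw [heq] at hmem
    rcases hmem with h' | h'
    · have := hgi (show 2 - 2 * t ∈ _ from ⟨by linarith, by linarith⟩) (show (0 : ℝ) ∈ _ by simp) (h'.trans hg0.symm)
      linarith
    · have := hgi (show 2 - 2 * t ∈ _ from ⟨by linarith, by linarith⟩) (show (1 : ℝ) ∈ _ by simp)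
        ((show g (2 - 2 * t) = b from h').trans hg1.symm)
      linarith
  refine isSimpleClosedCurve_of_loop hcont.continuousOn ?_ ?_
  · rw [hle 0 (by norm_num), hgt 1 (by norm_num)]
    norm_num [hf0, hg0]
  · intro s hs t ht hst
    rcases le_or_gt s (1 / 2) with h1 | h1 <;> rcases le_or_gt t (1 / 2) with h2 | h2
    · rw [hle s h1, hle t h2] at hst
      have := hfi ⟨by linarith [hs.1], by linarith⟩ ⟨by linarith [ht.1], by linarith⟩ hst
      linarith
    · exact absurd hst (hmix s t hs.1 h1 h2 ht.2)
    · exact absurd hst.symm (hmix t s ht.1 h2 h1 hs.2)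
    · rw [hgt s h1, hgt t h2] at hst
      have := hgi ⟨by linarith [hs.2], by linarith⟩ ⟨by linarith [ht.2], by linarith⟩ hst
      linarith

/-- If one of two arcs with the same endpoints has a point off the other, then that point lies on
a simple closed curve contained in their union. -/
theorem IsArc.exists_isSimpleClosedCurve [T2Space X] {A B : Set X} {a b x : X} (hA : IsArc A a b)
    (hB : IsArc B a b) (hxA : x ∈ A) (hxB : x ∉ B) :
    ∃ S ⊆ A ∪ B, IsSimpleClosedCurve S ∧ x ∈ S := by
  obtain ⟨A', hA', a', ha', b', hb', harc, hx, hint⟩ :=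
    hA.exists_subarc hB.isClosed hB.left_mem hB.right_mem hxA hxB
  obtain ⟨B', hB', harc'⟩ := hB.exists_subarc_of_mem ha' hb' harc.ne
  exact ⟨A' ∪ B', union_subset_union hA' hB', harc.isSimpleClosedCurve_union harc'
    ((inter_subset_inter_right _ hB').trans hint), .inl hx⟩

/-- A point on an arc whose endpoints lie in a connected set avoiding that point belongs to a
simple closed curve. -/
theorem IsArc.exists_isSimpleClosedCurve_of_isPreconnected [T2Space X] [CompactSpace X]
    [TopologicalSpace.MetrizableSpace X] [LocallyConnectedSpace X] {A G : Set X} {a b x : X}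
    (hA : IsArc A a b) (hG : IsPreconnected G) (ha : a ∈ G) (hb : b ∈ G) (hxA : x ∈ A)
    (hxG : x ∉ G) : ∃ S, IsSimpleClosedCurve S ∧ x ∈ S := by
  have hsub : G ⊆ {x}ᶜ := fun y hy h => hxG (h ▸ hy)
  -- The component of the complement of `x` that contains `G` is open and connected, hence contains
  -- an arc from `a` to `b` avoiding `x`.
  have hW := hG.subset_connectedComponentIn ha hsub
  obtain ⟨B, hB, hB'⟩ := exists_isArc_of_isOpen (isOpen_compl_singleton (x := x)).connectedComponentIn
    isPreconnected_connectedComponentIn (hW ha) (hW hb) hA.ne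
  obtain ⟨S, -, hS, hx⟩ := hA.exists_isSimpleClosedCurve hB' hxA
    fun h => connectedComponentIn_subset _ _ (hB h) rfl
  exact ⟨S, hS, hx⟩

end Arcs

/-! ### Dendrites: unique arcs, small neighborhoods, contractible loops -/

section Dendrites

theorem IsArc.eq_of_forall_not_isSimpleClosedCurve {X : Type*} [TopologicalSpace X] [T2Space X]
    {N A B : Set X} (hN : ∀ S ⊆ N, ¬ IsSimpleClosedCurve S) {a b : X} (hA : IsArc A a b)
    (hB : IsArc B a b) (hAN : A ⊆ N) (hBN : B ⊆ N) : A = B := by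
  have key : ∀ A B : Set X, IsArc A a b → IsArc B a b → A ⊆ N → B ⊆ N → A ⊆ B := by
    intro A B hA hB hAN hBN x hx
    by_contra h
    obtain ⟨S, hS, hS', -⟩ := hA.exists_isSimpleClosedCurve hB hx h
    exact hN S (hS.trans (union_subset hAN hBN)) hS'
  exact (key A B hA hB hAN hBN).antisymm (key B A hB hA hBN hAN)

variable {D : Type u} [TopologicalSpace D]

theorem IsDendrite.isArc_unique (hD : IsDendrite D) {A B : Set D} {a b : D} (hA : IsArc A a b)
    (hB : IsArc B a b) : A = B := by
  have := hD.continuum.metrizable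
  exact hA.eq_of_forall_not_isSimpleClosedCurve (N := univ) (fun S _ => hD.noCurve S) hB
    (subset_univ _) (subset_univ _)

theorem IsDendrite.exists_isArc (hD : IsDendrite D) {a b : D} (hab : a ≠ b) :
    ∃ A, IsArc A a b := by
  have := hD.continuum.metrizable
  have := hD.continuum.compact
  have := hD.continuum.connected
  have := hD.locallyConnected
  obtain ⟨A, -, hA⟩ := exists_isArc_of_isOpen isOpen_univ isPreconnected_univ (mem_univ a)
    (mem_univ b) hab
  exact ⟨A, hA⟩

/-- By the cycle lemma, a point of the arc outside `C` would lie on a simple closed curve. This lets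
separation by a point be tested on connected sets rather than on arcs. -/
theorem IsDendrite.isArc_subset (hD : IsDendrite D) {A C : Set D} {a b : D} (hA : IsArc A a b)
    (hC : IsPreconnected C) (ha : a ∈ C) (hb : b ∈ C) : A ⊆ C := by
  have := hD.continuum.metrizable
  have := hD.continuum.compact
  have := hD.locallyConnected
  intro x hx
  by_contra h
  obtain ⟨S, hS, -⟩ := hA.exists_isSimpleClosedCurve_of_isPreconnected hC ha hb hx h
  exact hD.noCurve S hS

/-- Components of the complement of `z` are open, so a limit point other than `z` has a component
meeting this one, hence equal to it. -/
theorem closure_connectedComponentIn_compl_singleton {X : Type*} [TopologicalSpace X]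
    [T1Space X] [LocallyConnectedSpace X] (z x : X) :
    closure (connectedComponentIn {z}ᶜ x) ⊆ connectedComponentIn {z}ᶜ x ∪ {z} := by
  intro w hw
  by_contra hcon
  simp only [mem_union, mem_singleton_iff, not_or] at hcon
  have hopen := (isOpen_compl_singleton (x := z)).connectedComponentIn (x := w)
  have hmem : w ∈ connectedComponentIn {z}ᶜ w := mem_connectedComponentIn hcon.2
  obtain ⟨v, hv, hv'⟩ := mem_closure_iff.1 hw _ hopen hmem
  exact hcon.1 (connectedComponentIn_eq hv' ▸ (connectedComponentIn_eq hv) ▸ hmem)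

/-- Every point of a dendrite has arbitrarily small open, uniquely arcwise connected neighborhoods
with finite boundary. -/
theorem IsDendrite.exists_small_nhd (hD : IsDendrite D) (x : D) {V : Set D} (hV : V ∈ 𝓝 x) :
    ∃ U : Set D, IsOpen U ∧ x ∈ U ∧ U ⊆ V ∧ (frontier U).Finite ∧ UniquelyArcwiseConnected U := by
  have := hD.continuum.metrizable
  have := hD.continuum.compact
  have := hD.locallyConnected
  -- An interior point `z` of the arc from `x` to `y` separates them. By compactness finitely many
  -- such `z` suffice for all `y` outside `interior V`; the neighborhood is the intersection of the
  -- corresponding components of `x`, and its boundary consists of some of these `z`.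
  have hsep : ∀ y ∈ (interior V)ᶜ, ∃ z, z ≠ x ∧ z ≠ y ∧ y ∉ connectedComponentIn {z}ᶜ x := by
    intro y hy
    have hxy : x ≠ y := fun h => hy (h ▸ mem_interior_iff_mem_nhds.2 hV)
    obtain ⟨A, hA⟩ := hD.exists_isArc hxy
    obtain ⟨f, hf, hinj, h0, h1, hfA⟩ := hA.exists_param
    have hne : f (1 / 2) ≠ x := fun h => by
      have := hinj (by norm_num) (by norm_num) (h.trans h0.symm)
      norm_num at this
    refine ⟨f (1 / 2), hne, fun h => ?_, fun h => ?_⟩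
    · have := hinj (by norm_num) (by norm_num) (h.trans h1.symm)
      norm_num at this
    · have hx : x ∈ connectedComponentIn {f (1 / 2)}ᶜ x := mem_connectedComponentIn hne.symm
      have := hD.isArc_subset hA isPreconnected_connectedComponentIn hx h
        (hfA ▸ mem_image_of_mem f (show (1 / 2 : ℝ) ∈ Icc 0 1 by norm_num))
      exact connectedComponentIn_subset _ _ this rfl
  choose! z hzx hzy hz using hsep
  have hcpt : IsCompact (interior V)ᶜ := isOpen_interior.isClosed_compl.isCompact
  obtain ⟨t, htV, ht⟩ := hcpt.elim_nhds_subcover (fun y => connectedComponentIn {z y}ᶜ y)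
    fun y hy => connectedComponentIn_mem_nhds
      (isOpen_compl_singleton.mem_nhds (hzy y hy).symm)
  have hxC : ∀ y ∈ t, x ∈ connectedComponentIn {z y}ᶜ x := fun y hy =>
    mem_connectedComponentIn (hzx y (htV y hy)).symm
  refine ⟨⋂ y ∈ t, connectedComponentIn {z y}ᶜ x, ?_, ?_, ?_, ?_, ?_⟩
  · exact isOpen_biInter_finset fun y _ => isOpen_compl_singleton.connectedComponentIn
  · exact mem_iInter₂.2 hxC
  · intro w hw
    by_contra hwV
    obtain ⟨y, hy, hwy⟩ := mem_iUnion₂.1 (ht fun h => hwV (interior_subset h))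
    have h1 := mem_iInter₂.1 hw y hy
    have h2 : y ∈ connectedComponentIn {z y}ᶜ y :=
      mem_connectedComponentIn (hzy y (htV y hy)).symm
    rw [connectedComponentIn_eq hwy, ← connectedComponentIn_eq h1] at h2
    exact hz y (htV y hy) h2
  · refine (t.finite_toSet.image z).subset fun w hw => ?_
    rw [(isOpen_biInter_finset fun y _ =>
      isOpen_compl_singleton.connectedComponentIn).frontier_eq] at hw
    obtain ⟨hw1, hw2⟩ := hw
    simp only [mem_iInter, not_forall] at hw2
    obtain ⟨y, hy, hwy⟩ := hw2
    have := closure_connectedComponentIn_compl_singleton (z y) x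
      (closure_mono (iInter₂_subset y hy) hw1)
    exact ⟨y, hy, (this.resolve_left hwy).symm⟩
  · intro p hp q hq hpq
    obtain ⟨A, hA⟩ := hD.exists_isArc hpq
    refine ⟨A, ⟨subset_iInter₂ fun y hy => ?_, hA⟩, fun B hB => hD.isArc_unique hB.2 hA⟩
    exact hD.isArc_subset hA isPreconnected_connectedComponentIn (mem_iInter₂.1 hp y hy)
      (mem_iInter₂.1 hq y hy)

/-- `m` is the first point of `K` as seen from `o`. -/
structure IsFirstPoint (o : D) (K : Set D) (m : D) : Prop where
  mem : m ∈ K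
  between : ∀ k ∈ K, ∀ C : Set D, IsPreconnected C → o ∈ C → k ∈ C → m ∈ C

theorem IsFirstPoint.eq_of_mem {o m : D} {K : Set D} (h : IsFirstPoint o K m) (ho : o ∈ K) :
    m = o :=
  h.between o ho {o} isPreconnected_singleton rfl rfl

/-- Follow an arc from `o` to one point `k` of `K` until it first hits `K`, at `f t`. If the arc `B`
to another point of `K` missed `f t`, then points just before `f t` would lie off `B ∪ K`, although
this connected set contains `o` and `k` and hence the whole arc. -/
theorem IsDendrite.exists_isFirstPoint (hD : IsDendrite D) (o : D) {K : Set D} (hK : IsClosed K)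
    (hconn : IsConnected K) : ∃ m, IsFirstPoint o K m := by
  have := hD.continuum.metrizable
  by_cases ho : o ∈ K
  · exact ⟨o, ho, fun _ _ _ _ h _ => h⟩
  obtain ⟨k, hk⟩ := hconn.nonempty
  obtain ⟨A, hA⟩ := hD.exists_isArc (a := o) (b := k) fun h => ho (h ▸ hk)
  obtain ⟨f, hf, hinj, h0, h1, hfA⟩ := hA.exists_param
  obtain ⟨t, ht⟩ := ((isCompact_Icc (a := (0 : ℝ)) (b := 1)).inter_right
    (hK.preimage hf)).exists_isLeast ⟨1, by simp, by simpa [h1] using hk⟩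
  have htK : f t ∈ K := ht.1.2
  have ht0 : 0 < t := ht.1.1.1.lt_of_ne fun h => ho (by rwa [← h, h0] at htK)
  refine ⟨f t, htK, fun k' hk' C hC hoC hk'C => ?_⟩
  obtain ⟨B, hB⟩ := hD.exists_isArc (a := o) (b := k') fun h => ho (h ▸ hk')
  refine hD.isArc_subset hB hC hoC hk'C ?_
  by_contra hcon
  have hev : ∀ᶠ s in 𝓝[<] t, f s ∉ B :=
    (hf.continuousAt.eventually (hB.isClosed.isOpen_compl.mem_nhds hcon)).filter_mono
      nhdsWithin_le_nhds
  obtain ⟨s, hsB, hs0, hst⟩ := (hev.and (Ioo_mem_nhdsLT ht0)).exists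
  have hs : s ∈ Icc (0 : ℝ) 1 := ⟨hs0.le, hst.le.trans ht.1.1.2⟩
  have hsK : f s ∉ K := fun h => absurd (ht.2 ⟨hs, h⟩) (not_le.2 hst)
  have hBK : IsPreconnected (B ∪ K) :=
    hB.isPreconnected.union k' hB.right_mem hk' hconn.isPreconnected
  rcases hD.isArc_subset hA hBK (.inl hB.left_mem) (.inr hk) (hfA ▸ mem_image_of_mem f hs) with h | h
  exacts [hsB h, hsK h]

/-- The arc from `o` to `m`, allowed to degenerate to a point; its initial pieces reach every point
other than `m` while avoiding `m`. -/
theorem IsDendrite.exists_segment (hD : IsDendrite D) (o m : D) :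
    ∃ A : Set D, IsCompact A ∧ IsPreconnected A ∧ o ∈ A ∧ m ∈ A ∧
      ∀ z ∈ A, z ≠ m → ∃ C : Set D, IsPreconnected C ∧ o ∈ C ∧ z ∈ C ∧ m ∉ C := by
  have := hD.continuum.metrizable
  rcases eq_or_ne o m with rfl | hom
  · exact ⟨{o}, isCompact_singleton, isPreconnected_singleton, rfl, rfl, fun z hz h => absurd hz h⟩
  obtain ⟨A, hA⟩ := hD.exists_isArc hom
  refine ⟨A, hA.isCompact, hA.isPreconnected, hA.left_mem, hA.right_mem, fun z hz hzm => ?_⟩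
  obtain ⟨f, hf, hinj, rfl, rfl, rfl⟩ := hA.exists_param
  obtain ⟨t, ht, rfl⟩ := hz
  have ht1 : t < 1 := ht.2.lt_of_ne fun h => hzm (h ▸ rfl)
  refine ⟨f '' Icc 0 t, isPreconnected_Icc.image _ hf.continuousOn,
    ⟨0, ⟨le_rfl, ht.1⟩, rfl⟩, ⟨t, ⟨ht.1, le_rfl⟩, rfl⟩, ?_⟩
  rintro ⟨s, hs, hs1⟩
  have := hinj ⟨hs.1, hs.2.trans ht.2⟩ ⟨zero_le_one, le_rfl⟩ hs1
  linarith [hs.2]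

/-- The first point of a continuously varying path depends continuously on the parameter. -/
theorem IsDendrite.continuous_firstPoint (hD : IsDendrite D) {P : Type*} [TopologicalSpace P]
    {o : D} {Γ : P × unitInterval → D} (hΓ : Continuous Γ) {m : P → D}
    (hm : ∀ p, IsFirstPoint o (range fun v => Γ (p, v)) (m p)) : Continuous m := by
  have := hD.continuum.metrizable
  have := hD.locallyConnected
  rw [continuous_iff_continuousAt]
  intro p W hW
  set V := connectedComponentIn (interior W) (m p)
  have hmW : m p ∈ interior W := mem_interior_iff_mem_nhds.2 hW
  have hV : IsOpen V := isOpen_interior.connectedComponentIn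
  have hmV : m p ∈ V := mem_connectedComponentIn hmW
  have hVW : V ⊆ W := (connectedComponentIn_subset _ _).trans interior_subset
  obtain ⟨A, hAc, hA, hoA, hmA, hAm⟩ := hD.exists_segment o (m p)
  obtain ⟨v₀, hv₀⟩ := (hm p).mem
  have hEc : IsCompact (A \ V) := hAc.diff hV
  -- Two open conditions suffice: the moving path keeps a point in `V`, and it misses the compact
  -- set `A \ V`, whose points precede `m p` as seen from `o`. The connected set `A ∪ V` then traps
  -- `m p'`.
  have h1 : ∀ᶠ p' in 𝓝 p, Γ (p', v₀) ∈ V := by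
    refine (hΓ.comp (Continuous.prodMk_left v₀)).continuousAt.eventually (hV.mem_nhds ?_)
    simpa only [Function.comp, hv₀] using hmV
  have h2 : ∀ᶠ p' in 𝓝 p, ∀ v ∈ (univ : Set unitInterval), Γ (p', v) ∉ A \ V := by
    refine isCompact_univ.eventually_forall_of_forall_eventually fun v _ => ?_
    refine hΓ.continuousAt.eventually (hEc.isClosed.isOpen_compl.mem_nhds ?_)
    rintro ⟨hvA, hvV⟩
    obtain ⟨C, hC, hoC, hvC, hmC⟩ := hAm _ hvA fun h => hvV (h ▸ hmV)
    exact hmC ((hm p).between _ ⟨v, rfl⟩ C hC hoC hvC)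
  show ∀ᶠ p' in 𝓝 p, m p' ∈ W
  filter_upwards [h1, h2] with p' hp1 hp2
  obtain ⟨v, hv⟩ := (hm p').mem
  have := (hm p').between _ ⟨v₀, rfl⟩ (A ∪ V)
    (hA.union (m p) hmA hmV isPreconnected_connectedComponentIn) (.inl hoA) (.inr hp1)
  rcases this with h | h
  · by_contra hcon
    refine hp2 v trivial ?_
    rw [show Γ (p', v) = m p' from hv]
    exact ⟨h, fun h' => hcon (hVW h')⟩
  · exact hVW h

/-- Loops in a subspace of a dendrite are null-homotopic. -/
theorem IsDendrite.path_homotopic_refl (hD : IsDendrite D) {Y : Type*} [TopologicalSpace Y]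
    {i : Y → D} (hi : IsEmbedding i) {x : Y} (γ : Path x x) : γ.Homotopic (Path.refl x) := by
  have := hD.continuum.metrizable
  -- At time `t` the homotopy sends `s` to the first point, seen from the base point, of γ on [s(1 -
  -- t), s]. This is γ(s) for `t = 0`, and the base point whenever the piece of γ passes through it,
  -- as for `t = 1` or `s = 1`. All values lie on γ, so the homotopy stays in `Y`.
  let α : (unitInterval × unitInterval) × unitInterval → Y := fun q =>
    γ.extend (q.1.2 * (1 - q.1.1 * q.2))
  have hα : Continuous α := γ.continuous_extend.comp (by fun_prop)
  have hiα : Continuous (i ∘ α) := hi.continuous.comp hα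
  have hex : ∀ p, ∃ v, IsFirstPoint (i x) (range fun v => i (α (p, v))) (i (α (p, v))) := by
    intro p
    have hc : Continuous fun v => i (α (p, v)) := hiα.comp (Continuous.prodMk_right p)
    obtain ⟨m, hm⟩ := hD.exists_isFirstPoint (i x) (isCompact_range hc).isClosed
      (isConnected_range hc)
    obtain ⟨v, rfl⟩ := hm.mem
    exact ⟨v, hm⟩
  choose v hv using hex
  have hcont : Continuous fun p => α (p, v p) :=
    hi.continuous_iff.2 (hD.continuous_firstPoint hiα hv)
  have hbase : ∀ p w, α (p, w) = x → α (p, v p) = x := fun p w hw =>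
    hi.injective ((hv p).eq_of_mem ⟨w, congrArg i hw⟩)
  refine ⟨⟨⟨⟨fun p => α (p, v p), hcont⟩, fun s => ?_, fun s => ?_⟩, fun t s hs => ?_⟩⟩
  · simp [α]
  · exact hbase _ 1 (by simp [α])
  · rcases hs with rfl | hs
    · simp [α]
    · rw [mem_singleton_iff] at hs
      subst hs
      refine (hbase (t, 1) 0 (by simp [α])).trans (by simp)

/-- Stated for connected open subspaces because it is needed both for a whole dendrite and for a
dendrite with one point removed. -/
theorem IsDendrite.isSimplyConnectedQuasiPolyhedron_of_isOpenEmbedding (hD : IsDendrite D)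
    {Y : Type u} [TopologicalSpace Y] [ConnectedSpace Y] {i : Y → D} (hi : IsOpenEmbedding i) :
    IsSimplyConnectedQuasiPolyhedron Y := by
  have := hD.continuum.metrizable
  have := hD.continuum.compact
  have := hD.locallyConnected
  have := LocallyPathConnectedSpace.of_locallyConnected_compact (X := D)
  have hlp : LocallyPathConnectedSpace Y := hi.locallyPathConnectedSpace
  have hT2 : T2Space Y := hi.isEmbedding.t2Space
  have hlc : LocallyCompactSpace Y := hi.locallyCompactSpace
  have hsc : SecondCountableTopology D := by
    let _ := TopologicalSpace.metrizableSpaceMetric D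
    infer_instance
  have hsY : SecondCountableTopology Y := hi.isEmbedding.secondCountableTopology
  refine ⟨⟨inferInstance, hT2, hlc, fun y V hV => ?_, inferInstance⟩,
    simply_connected_iff_loops_nullhomotopic.2 ⟨.of_locallyPathConnectedSpace,
      fun x γ => hD.path_homotopic_refl hi.isEmbedding γ⟩⟩
  obtain ⟨U, hU, hyU, hUV, hfin, huniq⟩ := hD.exists_small_nhd (i y) (hi.isOpenMap.image_mem_nhds hV)
  have hUr : U ⊆ range i := hUV.trans (image_subset_range _ _)
  refine ⟨i ⁻¹' U, hU.preimage hi.continuous, hyU, ?_, ?_, ?_⟩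
  · rw [← preimage_image_eq V hi.injective]
    exact preimage_mono hUV
  · rw [← hi.isOpenMap.preimage_frontier_eq_frontier_preimage hi.continuous]
    exact hfin.preimage hi.injective.injOn
  · intro p hp q hq hpq
    obtain ⟨A, ⟨hAU, hA⟩, -⟩ := huniq _ hp _ hq (hi.injective.ne hpq)
    refine ⟨i ⁻¹' A, ⟨preimage_mono hAU, hA.preimage hi.isEmbedding (hAU.trans hUr)⟩, ?_⟩
    rintro B ⟨-, hB⟩
    rw [← hD.isArc_unique (hB.image hi.isEmbedding) hA, preimage_image_eq _ hi.injective]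

end Dendrites

/-! ### Branches free of simple closed curves -/

section Branches

/-- The union of all arcs whose endpoints belong to simple closed curves. -/
def curveHull (X : Type u) [TopologicalSpace X] : Set X :=
  {x : X | ∃ (A : Set X) (a b : X), IsArc A a b ∧
    (∃ S : Set X, IsSimpleClosedCurve S ∧ a ∈ S) ∧
    (∃ T : Set X, IsSimpleClosedCurve T ∧ b ∈ T) ∧ x ∈ A}

variable {X : Type u} [TopologicalSpace X]

theorem IsSimpleClosedCurve.subset_curveHull [T2Space X] {S : Set X}
    (hS : IsSimpleClosedCurve S) : S ⊆ curveHull X := by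
  intro x hx
  obtain ⟨q, hq, hxq⟩ := hS.exists_ne hx
  obtain ⟨A, hAS, hA, -⟩ := hS.exists_isArc hx hq hx hxq
  exact ⟨A, x, q, hA, ⟨S, hS, hx⟩, ⟨S, hS, hq⟩, hA.left_mem⟩

/-- Two arcs that share only an endpoint form an arc. -/
theorem IsArc.union [T2Space X] {A B : Set X} {a b c : X} (hA : IsArc A a b) (hB : IsArc B b c)
    (hAB : A ∩ B ⊆ {b}) : IsArc (A ∪ B) a c := by
  obtain ⟨f, hf, hfi, hf0, hf1, rfl⟩ := hA.exists_param
  obtain ⟨g, hg, hgi, hg0, hg1, rfl⟩ := hB.exists_param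
  let h : ℝ → X := fun t => if t ≤ 1 then f t else g (t - 1)
  have hcont : Continuous h := by
    refine Continuous.if_le hf (by fun_prop) continuous_id continuous_const ?_
    rintro t rfl
    rw [sub_self, hf1, hg0]
  have hle : ∀ t, t ≤ 1 → h t = f t := fun t ht => if_pos ht
  have hgt : ∀ t, 1 < t → h t = g (t - 1) := fun t ht => if_neg (not_le.2 ht)
  have himg : h '' Icc 0 2 = f '' Icc 0 1 ∪ g '' Icc 0 1 := by
    apply subset_antisymm
    · rintro _ ⟨t, ht, rfl⟩
      rcases le_or_gt t 1 with h' | h'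
      · rw [hle t h']
        exact .inl ⟨_, ⟨ht.1, h'⟩, rfl⟩
      · rw [hgt t h']
        exact .inr ⟨_, ⟨by linarith, by linarith [ht.2]⟩, rfl⟩
    · rintro _ (⟨t, ht, rfl⟩ | ⟨t, ht, rfl⟩)
      · exact ⟨t, ⟨ht.1, by linarith [ht.2]⟩, hle t ht.2⟩
      · rcases ht.1.eq_or_lt with rfl | h'
        · exact ⟨1, by norm_num, by rw [hle 1 le_rfl, hg0, hf1]⟩
        · refine ⟨t + 1, ⟨by linarith, by linarith [ht.2]⟩, ?_⟩
          rw [hgt _ (by linarith), add_sub_cancel_right]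
  have hmix : ∀ s t : ℝ, 0 ≤ s → s ≤ 1 → 1 < t → t ≤ 2 → h s ≠ h t := by
    intro s t hs hs' ht ht' heq
    rw [hle s hs', hgt t ht] at heq
    have hmem : f s ∈ ({b} : Set X) :=
      hAB ⟨⟨_, ⟨hs, hs'⟩, rfl⟩, heq ▸ ⟨_, ⟨by linarith, by linarith⟩, rfl⟩⟩
    rw [heq] at hmem
    have := hgi (show t - 1 ∈ _ from ⟨by linarith, by linarith⟩) (show (0 : ℝ) ∈ _ by simp)
      ((show g (t - 1) = b from hmem).trans hg0.symm)
    linarith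
  have hinj : InjOn h (Icc 0 2) := by
    intro s hs t ht hst
    rcases le_or_gt s 1 with h1 | h1 <;> rcases le_or_gt t 1 with h2 | h2
    · rw [hle s h1, hle t h2] at hst
      exact hfi ⟨hs.1, h1⟩ ⟨ht.1, h2⟩ hst
    · exact absurd hst (hmix s t hs.1 h1 h2 ht.2)
    · exact absurd hst.symm (hmix t s ht.1 h2 h1 hs.2)
    · rw [hgt s h1, hgt t h2] at hst
      have := hgi ⟨by linarith, by linarith [hs.2]⟩ ⟨by linarith, by linarith [ht.2]⟩ hst
      linarith
  have := IsArc.of_continuousOn two_pos hcont.continuousOn hinj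
  rw [himg, hle 0 zero_le_one, hgt 2 one_lt_two, hf0] at this
  norm_num [hg1] at this
  exact this

/-- Otherwise the component would be clopen in a connected space. -/
theorem mem_closure_connectedComponentIn_compl_singleton [T1Space X] [LocallyConnectedSpace X]
    [PreconnectedSpace X] {e x : X} (hxe : x ≠ e) : e ∈ closure (connectedComponentIn {e}ᶜ x) := by
  by_contra hcon
  have hclosed : IsClosed (connectedComponentIn {e}ᶜ x) := by
    refine isClosed_of_closure_subset fun w hw => ?_
    rcases closure_connectedComponentIn_compl_singleton e x hw with h | rfl
    exacts [h, absurd hw hcon]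
  have huniv := IsClopen.eq_univ ⟨hclosed, isOpen_compl_singleton.connectedComponentIn⟩
    ⟨x, mem_connectedComponentIn hxe⟩
  have : e ∈ connectedComponentIn {e}ᶜ x := huniv ▸ mem_univ e
  exact connectedComponentIn_subset _ _ this rfl

/-- The closure of a component of the complement of a point, if it contains no simple closed
curve, is a dendrite. -/
theorem isDendrite_connectedComponentIn_union [CompactSpace X] [ConnectedSpace X]
    [TopologicalSpace.MetrizableSpace X] [LocallyConnectedSpace X] {e x : X} (hxe : x ≠ e)
    (hno : ∀ S ⊆ connectedComponentIn {e}ᶜ x ∪ {e}, ¬ IsSimpleClosedCurve S) :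
    IsDendrite ↥(connectedComponentIn {e}ᶜ x ∪ {e}) := by
  set Q := connectedComponentIn {e}ᶜ x with hQ
  have hcl : closure Q ⊆ Q ∪ {e} := closure_connectedComponentIn_compl_singleton e x
  have hecl : e ∈ closure Q := mem_closure_connectedComponentIn_compl_singleton hxe
  have hZ : IsClosed (Q ∪ {e}) := by
    refine isClosed_of_closure_subset ?_
    rw [closure_union, closure_singleton]
    exact union_subset hcl subset_union_right
  have hZc : CompactSpace ↥(Q ∪ {e}) := isCompact_iff_compactSpace.1 hZ.isCompact
  have hQo : IsOpen Q := isOpen_compl_singleton.connectedComponentIn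
  have hZconn : IsPreconnected (Q ∪ {e}) :=
    isPreconnected_connectedComponentIn.subset_closure subset_union_left
      (union_subset subset_closure (singleton_subset_iff.2 hecl))
  refine ⟨⟨hZc, isConnected_iff_connectedSpace.1 ⟨⟨e, .inr rfl⟩, hZconn⟩, inferInstance⟩, ?_, ?_⟩
  · classical
    -- Collapsing everything outside `Q` to `e` is a retraction, hence a quotient map, and quotients
    -- inherit local connectedness.
    let r : X → X := fun y => if y ∈ Q then y else e
    have hr : Continuous r := by
      refine Continuous.if (fun a ha => ?_) continuous_id continuous_const
      have ha' : a ∈ frontier Q := ha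
      rw [hQo.frontier_eq] at ha'
      exact (hcl ha'.1).resolve_left ha'.2
    have hrZ : ∀ y, r y ∈ Q ∪ {e} := by
      intro y
      by_cases hy : y ∈ Q <;> simp [r, hy]
    let ρ : X → ↥(Q ∪ {e}) := fun y => ⟨r y, hrZ y⟩
    have hρ : Continuous ρ := hr.subtype_mk _
    have hsurj : Function.Surjective ρ := by
      rintro ⟨y, hy⟩
      refine ⟨y, Subtype.ext ?_⟩
      rcases hy with hy | hy
      · simp [ρ, r, hy]
      · rw [mem_singleton_iff] at hy
        subst hy
        simp [ρ, r]
    exact (hρ.isClosedMap.isQuotientMap hρ hsurj).isCoinducing.locallyConnectedSpace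
  · intro S hS
    exact hno _ (by rintro _ ⟨y, -, rfl⟩; exact y.2) (hS.image IsEmbedding.subtypeVal)

/-- The branch with `e` adjoined is a dendrite that compactifies `Q` by the single point `e`, so `Q`
is the neighborhood excluding `x` from the skeleton. -/
theorem notMem_berkovichSkeleton_of_branch [CompactSpace X] [ConnectedSpace X]
    [TopologicalSpace.MetrizableSpace X] [LocallyConnectedSpace X] {e x : X} (hxe : x ≠ e)
    (hno : ∀ S ⊆ connectedComponentIn {e}ᶜ x ∪ {e}, ¬ IsSimpleClosedCurve S) :
    x ∉ berkovichSkeleton X := by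
  have hD := isDendrite_connectedComponentIn_union hxe hno
  set Q := connectedComponentIn {e}ᶜ x with hQ
  have hxQ : x ∈ Q := mem_connectedComponentIn hxe
  have heQ : e ∉ Q := fun h => connectedComponentIn_subset _ _ h rfl
  have hQo : IsOpen Q := isOpen_compl_singleton.connectedComponentIn
  have hQc : ConnectedSpace Q :=
    isConnected_iff_connectedSpace.1 ⟨⟨x, hxQ⟩, isPreconnected_connectedComponentIn⟩
  let j : Q → ↥(Q ∪ {e}) := inclusion subset_union_left
  have hrange : range j = {⟨e, .inr rfl⟩}ᶜ := by
    rw [range_inclusion]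
    ext ⟨y, hy⟩
    exact ⟨fun h h' => heQ (by cases h'; exact h),
      fun h => hy.resolve_right fun h' => h (Subtype.ext h')⟩
  have hj : IsOpenEmbedding j := by
    refine ⟨IsEmbedding.inclusion subset_union_left, ?_⟩
    rw [range_inclusion]
    exact hQo.preimage continuous_subtype_val
  have hdense : DenseRange j := by
    rintro ⟨y, hy⟩
    rw [closure_subtype, range_inclusion]
    have : Subtype.val '' {y : ↥(Q ∪ {e}) | (y : X) ∈ Q} = Q := by
      ext y
      simp
    rw [this]
    rcases hy with hy | rfl
    · exact subset_closure hy
    · exact mem_closure_connectedComponentIn_compl_singleton hxe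
  have := hD.continuum.connected
  refine not_not.2 ⟨Q, hQo, hxQ, hD.isSimplyConnectedQuasiPolyhedron_of_isOpenEmbedding hj,
    _, inferInstance, j, ⟨hD.continuum.compact,
      hD.isSimplyConnectedQuasiPolyhedron_of_isOpenEmbedding IsOpenEmbedding.id,
      ⟨⟨hj.isInducing, hdense⟩, hj.injective⟩⟩, ⟨e, .inr rfl⟩, by rw [hrange, compl_compl]⟩

theorem IsLocalDendrite.locallyConnectedSpace (hX : IsLocalDendrite X) :
    LocallyConnectedSpace X := by
  rw [locallyConnectedSpace_iff_connected_subsets]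
  intro x U hU
  obtain ⟨N, hN, hD⟩ := hX.exists_dendrite_nhd x
  have := hD.locallyConnected
  have hxN := mem_of_mem_nhds hN
  refine ⟨Subtype.val '' connectedComponentIn ((↑) ⁻¹' U) (⟨x, hxN⟩ : N), ?_,
    isPreconnected_connectedComponentIn.image _ continuous_subtype_val.continuousOn,
    image_subset_iff.2 (connectedComponentIn_subset _ _)⟩
  rw [← map_nhds_subtype_coe_eq_nhds hxN hN]
  exact image_mem_map (connectedComponentIn_mem_nhds
    (continuous_subtype_val.continuousAt.preimage_mem_nhds hU))

/-- In a local dendrite every point has a neighborhood with finite boundary inside a closed,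
arcwise connected set without simple closed curves. -/
theorem IsLocalDendrite.exists_nhd (hX : IsLocalDendrite X) (x : X) :
    ∃ N U : Set X, IsOpen U ∧ x ∈ U ∧ closure U ⊆ N ∧ (frontier U).Finite ∧
      (∀ S ⊆ N, ¬ IsSimpleClosedCurve S) ∧
      ∀ p ∈ N, ∀ q ∈ N, p ≠ q → ∃ A ⊆ N, IsArc A p q := by
  have := hX.continuum.metrizable
  obtain ⟨N, hN, hD⟩ := hX.exists_dendrite_nhd x
  have hNc : IsClosed N := (isCompact_iff_compactSpace.2 hD.continuum.compact).isClosed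
  have hxN := mem_of_mem_nhds hN
  obtain ⟨U, hU, hxU, hUN, hfin, -⟩ := hD.exists_small_nhd ⟨x, hxN⟩
    (V := (↑) ⁻¹' interior N)
    (continuous_subtype_val.continuousAt.preimage_mem_nhds (interior_mem_nhds.2 hN))
  have hopen : IsOpen (Subtype.val '' U) := by
    obtain ⟨O, hO, rfl⟩ := isOpen_induced_iff.1 hU
    have : (Subtype.val '' ((↑) ⁻¹' O : Set N)) = interior N ∩ O := by
      ext y
      constructor
      · rintro ⟨z, hz, rfl⟩
        exact ⟨hUN hz, hz⟩
      · rintro ⟨hy, hyO⟩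
        exact ⟨⟨y, interior_subset hy⟩, hyO, rfl⟩
    rw [this]
    exact isOpen_interior.inter hO
  have hcl : closure (Subtype.val '' U) = Subtype.val '' closure U :=
    hNc.isClosedEmbedding_subtypeVal.closure_image_eq U
  refine ⟨N, Subtype.val '' U, hopen, ⟨_, hxU, rfl⟩, ?_, ?_, ?_, ?_⟩
  · rw [hcl]
    rintro _ ⟨y, -, rfl⟩
    exact y.2
  · rw [hopen.frontier_eq, hcl, ← image_sdiff Subtype.val_injective, ← hU.frontier_eq]
    exact hfin.image _
  · intro S hS hS'
    exact hD.noCurve _ (hS'.preimage IsEmbedding.subtypeVal (by simpa using hS))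
  · intro p hp q hq hpq
    obtain ⟨A, hA⟩ := hD.exists_isArc (a := ⟨p, hp⟩) (b := ⟨q, hq⟩) (by simpa using hpq)
    exact ⟨_, by rintro _ ⟨y, -, rfl⟩; exact y.2, hA.image IsEmbedding.subtypeVal⟩

/-- A point off the union of arcs joining simple closed curves lies on a branch without simple
closed curves that is attached at a single point. -/
theorem IsLocalDendrite.exists_branch (hX : IsLocalDendrite X) (hnd : ¬ IsDendrite X) {x : X}
    (hx : x ∉ curveHull X) :
    ∃ e, x ≠ e ∧ ∀ S ⊆ connectedComponentIn {e}ᶜ x ∪ {e}, ¬ IsSimpleClosedCurve S := by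
  have := hX.continuum.metrizable
  have := hX.continuum.compact
  have := hX.continuum.connected
  have := hX.locallyConnectedSpace
  obtain ⟨S₀, hS₀⟩ : ∃ S : Set X, IsSimpleClosedCurve S := by
    by_contra! h
    exact hnd ⟨hX.continuum, inferInstance, h⟩
  obtain ⟨a, ha⟩ := hS₀.nonempty
  have hne : ∀ T, IsSimpleClosedCurve T → x ∉ T := fun T hT h => hx (hT.subset_curveHull h)
  have hax : a ≠ x := fun h => hne S₀ hS₀ (h ▸ ha)
  -- All simple closed curves lie in this one component, since an arc joining two of them cannot
  -- pass through `x`.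
  set W := connectedComponentIn {x}ᶜ a with hWdef
  have haW : a ∈ W := mem_connectedComponentIn hax
  have hTW : ∀ T, IsSimpleClosedCurve T → T ⊆ W := by
    intro T hT t ht
    rcases eq_or_ne a t with rfl | hat
    · exact haW
    obtain ⟨A, -, hA⟩ := exists_isArc_of_isOpen isOpen_univ isPreconnected_univ (mem_univ a)
      (mem_univ t) hat
    have hAx : A ⊆ {x}ᶜ := fun y hy hyx => hx
      (hyx ▸ ⟨A, a, t, hA, ⟨S₀, hS₀, ha⟩, ⟨T, hT, ht⟩, hy⟩)
    exact hA.isPreconnected.subset_connectedComponentIn hA.left_mem hAx hA.right_mem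
  have hxW : x ∉ W := fun h => connectedComponentIn_subset _ _ h rfl
  have harc : ∀ p ∈ W, ∀ q ∈ W, ∀ A, IsArc A p q → x ∉ A := by
    intro p hp q hq A hA hxA
    obtain ⟨S, hS, hxS⟩ := hA.exists_isSimpleClosedCurve_of_isPreconnected
      isPreconnected_connectedComponentIn hp hq hxA hxW
    exact hne S hS hxS
  obtain ⟨N, U, hU, hxU, hUN, hfin, hNno, hNarc⟩ := hX.exists_nhd x
  have hxN : x ∈ N := hUN (subset_closure hxU)
  obtain ⟨w₀, hw₀U, hw₀⟩ := mem_closure_iff.1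
    (mem_closure_connectedComponentIn_compl_singleton hax) U hU hxU
  obtain ⟨G, hGN, hG⟩ := hNarc x hxN w₀ (hUN (subset_closure hw₀U)) fun h => hxW (h ▸ hw₀)
  obtain ⟨g, hg, hgi, hg0, hg1, rfl⟩ := hG.exists_param
  -- The arcs in `N` from `x` to `w₀` and to `f` share an initial segment: if they met only at `x`,
  -- their union would be an arc through `x` between points of `W`.
  have hinit : ∀ f ∈ frontier U ∩ W, ∀ᶠ t in 𝓝[>] (0 : ℝ), ∀ B ⊆ N, IsArc B x f → g t ∈ B := by
    rintro f ⟨hfU, hfW⟩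
    obtain ⟨B, hBN, hB⟩ := hNarc x hxN f (hUN (frontier_subset_closure hfU))
      fun h => hxW (h ▸ hfW)
    obtain ⟨t₁, ht₁⟩ := ((isCompact_Icc (a := (0 : ℝ)) (b := 1)).inter_right
      (hB.isClosed.preimage hg)).exists_isGreatest ⟨0, by simp, by simpa [hg0] using hB.left_mem⟩
    have ht₁B : g t₁ ∈ B := ht₁.1.2
    have ht₁0 : 0 < t₁ := by
      refine ht₁.1.1.1.lt_of_ne fun h => ?_
      have hint : g '' Icc 0 1 ∩ B ⊆ {x} := by
        rintro _ ⟨⟨t, ht, rfl⟩, htB⟩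
        have : t ≤ t₁ := ht₁.2 ⟨ht, htB⟩
        rw [← h] at this
        rw [mem_singleton_iff, ← hg0, this.antisymm ht.1]
      exact harc w₀ hw₀ f hfW _ (hG.symm.union hB hint) (.inr hB.left_mem)
    have hne' : x ≠ g t₁ := fun h => by
      have := hgi ht₁.1.1 (by simp) (h.symm.trans hg0.symm)
      exact ht₁0.ne' this
    have hGt : IsArc (g '' Icc 0 t₁) x (g t₁) := by
      rw [← hg0]
      exact .of_continuousOn ht₁0 hg.continuousOn (hgi.mono (Icc_subset_Icc_right ht₁.1.1.2))
    obtain ⟨B', hB'B, hB'⟩ := hB.exists_subarc_of_mem hB.left_mem ht₁B hne'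
    have heq := hGt.eq_of_forall_not_isSimpleClosedCurve hNno hB'
      ((image_mono (Icc_subset_Icc_right ht₁.1.1.2)).trans hGN) (hB'B.trans hBN)
    filter_upwards [Ioo_mem_nhdsGT ht₁0] with t ht C hCN hC
    rw [hC.eq_of_forall_not_isSimpleClosedCurve hNno hB hCN hBN]
    exact hB'B (heq ▸ mem_image_of_mem g ⟨ht.1.le, ht.2.le⟩)
  -- The boundary of `U` is finite, so one point `g t` lies on the arcs in `N` from `x` to all
  -- boundary points in `W`. It is the attaching point `e`.
  obtain ⟨t, ht, ht0, ht1⟩ := (((eventually_all_finite (hfin.subset inter_subset_left)).2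
    hinit).and (Ioo_mem_nhdsGT zero_lt_one)).exists
  have htI : t ∈ Icc (0 : ℝ) 1 := ⟨ht0.le, ht1.le⟩
  have hxe : x ≠ g t := fun h => ht0.ne (hgi (by simp) htI (hg0.trans h))
  refine ⟨g t, hxe, fun T hTQ hT => ?_⟩
  -- A curve on the branch leaves `N`. An arc avoiding `e` from `x` to the curve first leaves `U` at
  -- a boundary point in `W`, and its part up to there must pass through `e`.
  obtain ⟨y, hyT, hyN⟩ := not_subset.1 fun h => hNno T h hT
  have hye : y ≠ g t := fun h => hyN (h ▸ hGN (mem_image_of_mem g htI))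
  have hyQ := (hTQ hyT).resolve_right hye
  have hxy : x ≠ y := fun h => hne T hT (h ▸ hyT)
  obtain ⟨K, hKQ, hK⟩ := exists_isArc_of_isOpen
    (isOpen_compl_singleton (x := g t)).connectedComponentIn isPreconnected_connectedComponentIn
    (mem_connectedComponentIn hxe) hyQ hxy
  obtain ⟨k, hk, hki, hk0, hk1, rfl⟩ := hK.exists_param
  obtain ⟨s, hs⟩ := ((isCompact_Icc (a := (0 : ℝ)) (b := 1)).inter_right
    (hU.isClosed_compl.preimage hk)).exists_isLeast
    ⟨1, by simp, fun h => hyN (hUN (subset_closure (hk1 ▸ h)))⟩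
  have hsU : k s ∉ U := hs.1.2
  have hs0 : 0 < s := hs.1.1.1.lt_of_ne fun h => hsU (by rwa [← h, hk0])
  have hlt : ∀ u ∈ Ico 0 s, k u ∈ U := fun u hu => by
    by_contra h
    exact absurd (hs.2 ⟨⟨hu.1, hu.2.le.trans hs.1.1.2⟩, h⟩) (not_le.2 hu.2)
  have hscl : k s ∈ closure U := by
    refine mem_closure_of_tendsto (hk.continuousAt.tendsto.mono_left
      (nhdsWithin_le_nhds (s := Iio s))) ?_
    filter_upwards [Ioo_mem_nhdsLT hs0] with u hu
    exact hlt u ⟨hu.1.le, hu.2⟩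
  have hsub : k '' Icc 0 s ⊆ closure U := by
    rintro _ ⟨u, hu, rfl⟩
    rcases hu.2.eq_or_lt with rfl | h
    · exact hscl
    · exact subset_closure (hlt u ⟨hu.1, h⟩)
  have hfW : k s ∈ W := by
    have hyW := hTW T hT hyT
    rw [hWdef, connectedComponentIn_eq hyW]
    have hpre : IsPreconnected (k '' Icc s 1) := isPreconnected_Icc.image _ hk.continuousOn
    refine hpre.subset_connectedComponentIn ⟨1, ⟨hs.1.1.2, le_rfl⟩, hk1⟩ ?_
      ⟨s, ⟨le_rfl, hs.1.1.2⟩, rfl⟩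
    rintro _ ⟨u, hu, rfl⟩ hux
    have := hki ⟨hs0.le.trans hu.1, hu.2⟩ (show (0 : ℝ) ∈ _ by simp)
      ((show k u = x from hux).trans hk0.symm)
    linarith [hu.1]
  have hKs : IsArc (k '' Icc 0 s) x (k s) := by
    rw [← hk0]
    exact .of_continuousOn hs0 hk.continuousOn (hki.mono (Icc_subset_Icc_right hs.1.1.2))
  have := ht (k s) ⟨hU.frontier_eq ▸ ⟨hscl, hsU⟩, hfW⟩ _ (hsub.trans hUN) hKs
  exact connectedComponentIn_subset _ _
    (hKQ (image_mono (Icc_subset_Icc_right hs.1.1.2) this)) rfl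

end Branches

/-! ### Simple closed curves against simple connectedness -/

section NoCurves

theorem UniquelyArcwiseConnected.joinedIn {Y : Type u} [TopologicalSpace Y] {U : Set Y}
    (hU : UniquelyArcwiseConnected U) {x y : Y} (hx : x ∈ U) (hy : y ∈ U) : JoinedIn U x y := by
  rcases eq_or_ne x y with rfl | hxy
  · exact JoinedIn.refl hx
  obtain ⟨A, ⟨hAU, f, hf, h0, h1, rfl⟩, -⟩ := hU x hx y hy hxy
  exact ⟨⟨⟨f, hf.continuous⟩, h0, h1⟩, fun t => hAU (mem_range_self t)⟩

/-- Needed to lift circle-valued maps to the line and to find arcs in connected open sets. -/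
theorem IsQuasiPolyhedron.locallyPathConnectedSpace {Y : Type u} [TopologicalSpace Y]
    (hY : IsQuasiPolyhedron Y) : LocallyPathConnectedSpace Y := by
  rw [locallyPathConnectedSpace_iff_pathComponentIn_mem_nhds]
  intro x V hV hxV
  obtain ⟨U, hU, hxU, hUV, -, huniq⟩ := hY.exists_small_nhd x V (hV.mem_nhds hxV)
  exact mem_of_superset (hU.mem_nhds hxU) fun y hy => (huniq.joinedIn hxU hy).mono hUV

/-- A compact metrizable simply connected quasi-polyhedron contains no simple closed curve. -/
theorem IsSimplyConnectedQuasiPolyhedron.not_isSimpleClosedCurve {Y : Type u} [TopologicalSpace Y]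
    [CompactSpace Y] [TopologicalSpace.MetrizableSpace Y]
    (hY : IsSimplyConnectedQuasiPolyhedron Y) (S : Set Y) : ¬ IsSimpleClosedCurve S := by
  classical
  intro hS
  have := hY.quasiPolyhedron.locallyPathConnectedSpace
  have := hY.simplyConnected
  have hT4 : NormalSpace Y := inferInstance
  obtain ⟨p, hp⟩ := hS.nonempty
  obtain ⟨g, hg, hg0, hg1, hgm, -, -⟩ := hS.exists_param hp
  obtain ⟨U, hU, hpU, -, -, huniq⟩ := hY.quasiPolyhedron.exists_small_nhd p univ univ_mem
  have hgp : ∀ t ∈ Ioo (0 : ℝ) 1, g t ≠ p := fun t ht h =>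
    ht.1.ne' (injOn_of_eq_add_int hgm 0 ⟨ht.1.le, by linarith [ht.2]⟩ (by simp) (h.trans hg0.symm))
  -- two short arcs of the curve at `p`, on either side
  obtain ⟨δ, hδ0, hδ1, hδl, hδr⟩ : ∃ δ > 0, δ < 1 / 2 ∧ (∀ t ∈ Icc 0 δ, g t ∈ U) ∧
      ∀ t ∈ Icc (1 - δ) 1, g t ∈ U := by
    have h0 : ∀ᶠ t in 𝓝 (0 : ℝ), g t ∈ U :=
      hg.continuousAt.eventually (hU.mem_nhds (by rwa [hg0]))
    have h1 : ∀ᶠ t in 𝓝 (1 : ℝ), g t ∈ U :=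
      hg.continuousAt.eventually (hU.mem_nhds (by rwa [hg1]))
    obtain ⟨a, ha, ha'⟩ := Metric.eventually_nhds_iff.1 h0
    obtain ⟨b, hb, hb'⟩ := Metric.eventually_nhds_iff.1 h1
    refine ⟨min (min a b) 1 / 3, by positivity, ?_, fun t ht => ha' ?_, fun t ht => hb' ?_⟩
    · linarith [min_le_right (min a b) 1]
    · have := (min_le_left (min a b) 1).trans (min_le_left a b)
      rw [Real.dist_eq, sub_zero, abs_of_nonneg ht.1]
      linarith [ht.2]
    · have := (min_le_left (min a b) 1).trans (min_le_right a b)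
      rw [Real.dist_eq, abs_lt]
      constructor <;> linarith [ht.2, ht.1]
  have hUp : IsOpen (U \ {p}) := hU.sdiff isClosed_singleton
  set L := connectedComponentIn (U \ {p}) (g δ) with hLdef
  have hLo : IsOpen L := hUp.connectedComponentIn
  set R := (U \ {p}) \ L with hRdef
  have hRo : IsOpen R := by
    rw [isOpen_iff_mem_nhds]
    rintro w ⟨hwU, hwL⟩
    refine mem_of_superset (hUp.connectedComponentIn.mem_nhds (mem_connectedComponentIn hwU))
      fun v hv => ⟨connectedComponentIn_subset _ _ hv, fun hvL => hwL ?_⟩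
    rw [hLdef, connectedComponentIn_eq hvL, ← connectedComponentIn_eq hv]
    exact mem_connectedComponentIn hwU
  have hgl : ∀ t ∈ Ioc 0 δ, g t ∈ L := by
    intro t ht
    have hpre : IsPreconnected (g '' Ioc 0 δ) := isPreconnected_Ioc.image _ hg.continuousOn
    refine hpre.subset_connectedComponentIn ⟨δ, ⟨hδ0, le_rfl⟩, rfl⟩ ?_ ⟨t, ht, rfl⟩
    rintro _ ⟨u, hu, rfl⟩
    exact ⟨hδl u ⟨hu.1.le, hu.2⟩, hgp u ⟨hu.1, by linarith [hu.2]⟩⟩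
  -- The curve enters and leaves `p` on different sides: an arc inside `L` joining them would be a
  -- second arc in `U`, besides the one through `p`.
  have hgr : ∀ t ∈ Ico (1 - δ) 1, g t ∈ R := by
    have hmem : ∀ u ∈ Ico (1 - δ) 1, g u ∈ U \ {p} := fun u hu =>
      ⟨hδr u ⟨hu.1, hu.2.le⟩, hgp u ⟨by linarith [hu.1], hu.2⟩⟩
    intro t ht
    refine ⟨hmem t ht, fun htL => ?_⟩
    have hinj : InjOn g (Icc 0 (1 - δ)) := (injOn_of_eq_add_int hgm 0).mono
      (Icc_subset_Ico_right (by linarith))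
    have hinj' : InjOn g (Ioc 0 1) := by
      intro s hs u hu hsu
      rcases hs.2.eq_or_lt with rfl | hs1 <;> rcases hu.2.eq_or_lt with rfl | hu1
      · rfl
      · exact absurd (hsu.symm.trans hg1) (hgp u ⟨hu.1, hu1⟩)
      · exact absurd (hsu.trans hg1) (hgp s ⟨hs.1, hs1⟩)
      · exact injOn_of_eq_add_int hgm 0 ⟨hs.1.le, by linarith⟩ ⟨hu.1.le, by linarith⟩ hsu
    have hl : IsArc (g '' Icc 0 δ) p (g δ) := by
      rw [← hg0]
      exact .of_continuousOn hδ0 hg.continuousOn (hinj.mono (Icc_subset_Icc_right (by linarith)))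
    have hr : IsArc (g '' Icc t 1) (g t) p := by
      rw [← hg1]
      exact .of_continuousOn ht.2 hg.continuousOn
        (hinj'.mono (Icc_subset_Ioc (by linarith [ht.1]) le_rfl))
    have hlr : g '' Icc t 1 ∩ g '' Icc 0 δ ⊆ {p} := by
      rintro _ ⟨⟨u, hu, rfl⟩, v, hv, hvu⟩
      rcases hu.2.eq_or_lt with rfl | hu1
      · exact hg1
      · have := injOn_of_eq_add_int hgm 0 ⟨hv.1, by linarith [hv.2]⟩
          ⟨by linarith [hu.1, ht.1], by linarith⟩ hvu
        linarith [hv.2, hu.1, ht.1]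
    have harc := hr.union hl hlr
    obtain ⟨A, hAL, hA⟩ := exists_isArc_of_isOpen hLo isPreconnected_connectedComponentIn htL
      (hgl δ ⟨hδ0, le_rfl⟩) harc.ne
    have hLU : L ⊆ U := (connectedComponentIn_subset _ _).trans sdiff_subset
    have heq := (huniq _ (hmem t ht).1 _ (hδl δ ⟨hδ0.le, le_rfl⟩) harc.ne).unique
      ⟨hAL.trans hLU, hA⟩ ⟨union_subset ?_ ?_, harc⟩
    · have hpA : p ∈ A := by
        rw [heq]
        exact .inl hr.right_mem
      exact (connectedComponentIn_subset _ _ (hAL hpA)).2 rfl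
    · rintro _ ⟨u, hu, rfl⟩
      exact hδr u ⟨ht.1.trans hu.1, hu.2⟩
    · rintro _ ⟨u, hu, rfl⟩
      exact hδl u hu
  have hfr : ∀ w ∈ frontier R, w = p ∨ w ∈ Uᶜ := by
    intro w hw
    rw [hRo.frontier_eq] at hw
    by_contra! hcon
    have hwU : w ∈ U \ {p} := ⟨not_not.1 hcon.2, hcon.1⟩
    have hwL : w ∈ L := by
      by_contra h
      exact hw.2 ⟨hwU, h⟩
    obtain ⟨v, hvL, hvR⟩ := mem_closure_iff.1 hw.1 L hLo hwL
    exact hvR.2 hvL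
  obtain ⟨φ, hφU, hφp, -⟩ := exists_continuous_zero_one_of_isClosed hU.isClosed_compl
    (isClosed_singleton (x := p)) (disjoint_left.2 fun w hw hwp => hw (hwp ▸ hpU))
  have hφp' : φ p = 1 := hφp rfl
  -- The angle `k` jumps at `p` from π on the `L` side to -π on the `R` side. Its exponential `f` is
  -- continuous, because `φ` is 0 or 1 on the boundary of `R`.
  let k : Y → ℝ := fun y => if y ∈ R then -(Real.pi * φ y) else Real.pi * φ y
  let f : Y → Circle := fun y =>
    if y ∈ R then Circle.exp (-(Real.pi * φ y)) else Circle.exp (Real.pi * φ y)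
  have hkf : ∀ y, Circle.exp (k y) = f y := fun y => by
    by_cases hy : y ∈ R <;> simp [k, f, hy]
  have hf : Continuous f := by
    refine Continuous.if (fun w hw => ?_) (Circle.exp.continuous.comp (by fun_prop))
      (Circle.exp.continuous.comp (by fun_prop))
    rcases hfr w hw with rfl | hw
    · rw [hφp', mul_one]
      refine Circle.exp_eq_exp.2 ⟨-1, ?_⟩
      push_cast
      ring
    · have : φ w = 0 := hφU hw
      simp [this]
  have hk : ContinuousOn k {p}ᶜ := by
    refine ContinuousOn.if (fun w hw => ?_) (by fun_prop) (by fun_prop)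
    have : φ w = 0 := hφU ((hfr w hw.2).resolve_left hw.1)
    simp [this]
  obtain ⟨F, ⟨-, hF⟩, -⟩ := Circle.isCoveringMap_exp.existsUnique_continuousMap_lifts ⟨f, hf⟩ p
    (k p) (hkf p)
  -- `F` is a global lift of `f`, and `k` is a lift that is continuous off `p`. Their difference
  -- takes discrete values, so it is constant along the curve minus `p`; its limits at the two ends
  -- differ by 2π.
  have hFk : ∀ y, F y - k y ∈ (AddSubgroup.zmultiples (2 * Real.pi) : Set ℝ) := by
    intro y
    have h1 : Circle.exp (F y) = Circle.exp (k y) := (congrFun hF y).trans (hkf y).symm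
    obtain ⟨m, hm⟩ := Circle.exp_eq_exp.1 h1
    refine ⟨m, ?_⟩
    simp only [zsmul_eq_mul]
    linarith
  have hcont : ContinuousOn (fun t => F (g t) - k (g t)) (Ioo 0 1) :=
    (F.continuous.comp hg).continuousOn.sub (hk.comp hg.continuousOn fun t ht => hgp t ht)
  have hconst : ∀ s ∈ Ioo (0 : ℝ) 1, ∀ t ∈ Ioo (0 : ℝ) 1, F (g s) - k (g s) = F (g t) - k (g t) :=
    fun s hs t ht => isPreconnected_Ioo.constant_of_mapsTo
      (isDiscrete_iff_discreteTopology.2 (inferInstanceAs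
        (DiscreteTopology (AddSubgroup.zmultiples (2 * Real.pi))))) hcont (fun u _ => hFk _) hs ht
  set c := F (g (1 / 2)) - k (g (1 / 2))
  have hlim0 : Tendsto (fun t => F (g t) - Real.pi * φ (g t)) (𝓝[>] 0) (𝓝 (F p - Real.pi)) := by
    have : Continuous fun t => F (g t) - Real.pi * φ (g t) := by fun_prop
    have h := (this.tendsto 0).mono_left (nhdsWithin_le_nhds (s := Ioi 0))
    simpa [hg0, hφp'] using h
  have hlim1 : Tendsto (fun t => F (g t) + Real.pi * φ (g t)) (𝓝[<] 1) (𝓝 (F p + Real.pi)) := by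
    have : Continuous fun t => F (g t) + Real.pi * φ (g t) := by fun_prop
    have h := (this.tendsto 1).mono_left (nhdsWithin_le_nhds (s := Iio 1))
    simpa [hg1, hφp'] using h
  have hc0 : F p - Real.pi = c := by
    refine tendsto_nhds_unique hlim0 (tendsto_const_nhds.congr' ?_)
    filter_upwards [Ioo_mem_nhdsGT hδ0] with t ht
    have hL := hgl t ⟨ht.1, ht.2.le⟩
    have : g t ∉ R := fun h => h.2 hL
    refine (hconst (1 / 2) (by norm_num) t ⟨ht.1, by linarith [ht.2]⟩).trans ?_
    simp [k, this]
  have hc1 : F p + Real.pi = c := by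
    refine tendsto_nhds_unique hlim1 (tendsto_const_nhds.congr' ?_)
    filter_upwards [Ioo_mem_nhdsLT (show 1 - δ < 1 by linarith)] with t ht
    have hR := hgr t ⟨ht.1.le, ht.2⟩
    refine (hconst (1 / 2) (by norm_num) t ⟨by linarith [ht.1], ht.2⟩).trans ?_
    simp [k, hR]
  linarith [Real.pi_pos]

/-- A Hausdorff continuous image of a compact metrizable space is metrizable. -/
theorem metrizableSpace_of_surjective {X Y : Type*} [TopologicalSpace X] [TopologicalSpace Y]
    [CompactSpace X] [TopologicalSpace.MetrizableSpace X] [T2Space Y] {f : X → Y}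
    (hf : Continuous f) (hsurj : Function.Surjective f) : TopologicalSpace.MetrizableSpace Y := by
  have hYc : CompactSpace Y := hsurj.compactSpace hf
  have hsc : SecondCountableTopology X := by
    let _ := TopologicalSpace.metrizableSpaceMetric X
    infer_instance
  have hB := TopologicalSpace.isBasis_countableBasis X
  set B := TopologicalSpace.countableBasis X
  -- `W s` consists of the points whose whole fibre is covered by `s`; it is open for open covers
  -- because `f` is a closed map.
  let W : Set (Set X) → Set Y := fun s => (f '' (⋃₀ s)ᶜ)ᶜ
  have hbasis : TopologicalSpace.IsTopologicalBasis (W '' {s | s.Finite ∧ s ⊆ B}) := by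
    refine TopologicalSpace.isTopologicalBasis_of_isOpen_of_nhds ?_ fun y V hy hV => ?_
    · rintro _ ⟨s, ⟨-, hs⟩, rfl⟩
      exact (hf.isClosedMap _ (isOpen_sUnion fun u hu => hB.isOpen (hs hu)).isClosed_compl).isOpen_compl
    · have hK : IsCompact (f ⁻¹' {y}) := (isClosed_singleton.preimage hf).isCompact
      have : ∀ x ∈ f ⁻¹' {y}, ∃ u ∈ B, x ∈ u ∧ u ⊆ f ⁻¹' V := fun x hx =>
        hB.exists_subset_of_mem_open (show x ∈ f ⁻¹' V by rw [mem_preimage, show f x = y from hx]; exact hy)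
          (hV.preimage hf)
      choose! u huB hxu huV using this
      obtain ⟨t, ht, hcov⟩ := hK.elim_nhds_subcover u fun x hx => (hB.isOpen (huB x hx)).mem_nhds (hxu x hx)
      refine ⟨_, ⟨u '' t, ⟨t.finite_toSet.image u, ?_⟩, rfl⟩, ?_, ?_⟩
      · rintro _ ⟨x, hx, rfl⟩
        exact huB x (ht x hx)
      · rintro ⟨x, hx, hxy⟩
        apply hx
        rw [sUnion_image]
        exact hcov hxy
      · intro z hz
        obtain ⟨x, rfl⟩ := hsurj z
        by_contra hzV
        refine hz ⟨x, fun hx => hzV ?_, rfl⟩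
        obtain ⟨_, ⟨x', hx', rfl⟩, hxx'⟩ := hx
        exact huV x' (ht x' hx') hxx'
  have : SecondCountableTopology Y := hbasis.secondCountableTopology
    ((countable_ofPred_finite_subset (TopologicalSpace.countable_countableBasis X)).image W)
  infer_instance

/-- A simply connected quasi-polyhedral open subset with a single endpoint does not meet any arc
joining simple closed curves. -/
theorem notMem_curveHull_of_hasSingleEndpoint {X : Type u} [TopologicalSpace X] [CompactSpace X]
    [TopologicalSpace.MetrizableSpace X] {Q : Set X} (hQ : IsOpen Q) (hend : HasSingleEndpoint Q)
    {x : X} (hxQ : x ∈ Q) : x ∉ curveHull X := by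
  classical
  obtain ⟨Y, _, j, ⟨hYc, hY, hj⟩, e, he⟩ := hend
  have hT2 := hY.quasiPolyhedron.hausdorff
  have hje : ∀ q, j q ≠ e := fun q h => by
    have : e ∈ (range j)ᶜ := he ▸ rfl
    exact this ⟨q, h⟩
  -- Collapse the complement of `Q` to the endpoint `e`. Continuity at `e` holds because the
  -- complement of an open set containing `e` is a compact subset of the range of `j`.
  let π : X → Y := fun y => if h : y ∈ Q then j ⟨y, h⟩ else e
  have hπQ : ∀ y (h : y ∈ Q), π y = j ⟨y, h⟩ := fun y h => dif_pos h
  have hπe : ∀ y, y ∉ Q → π y = e := fun y h => dif_neg h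
  have hπ : Continuous π := by
    refine continuous_def.2 fun V hV => ?_
    by_cases heV : e ∈ V
    · have hsub : Vᶜ ⊆ range j := fun y hy => by
        by_contra h
        have : y ∈ ({e} : Set Y) := he ▸ h
        exact hy (this ▸ heV)
      have hcpt : IsCompact (j ⁻¹' Vᶜ) :=
        (hj.isInducing.isCompact_preimage_iff hsub).2 hV.isClosed_compl.isCompact
      have heq : π ⁻¹' V = (Subtype.val '' (j ⁻¹' Vᶜ))ᶜ := by
        ext y
        by_cases hy : y ∈ Q <;> simp [hπQ, hπe, hy, heV]
      rw [heq]
      exact (hcpt.image continuous_subtype_val).isClosed.isOpen_compl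
    · have heq : π ⁻¹' V = Subtype.val '' (j ⁻¹' V) := by
        ext y
        by_cases hy : y ∈ Q <;> simp [hπQ, hπe, hy, heV]
      rw [heq]
      exact hQ.isOpenMap_subtype_val _ (hV.preimage hj.continuous)
  -- If `Q` were all of `X`, the range of `j` would be compact and dense, hence would contain `e`.
  have hne : ∃ y, y ∉ Q := by
    by_contra! h
    have : CompactSpace Q := by
      rw [← isCompact_iff_compactSpace, eq_univ_of_forall h]
      exact isCompact_univ
    have hcl := (isCompact_range hj.continuous).isClosed
    have : e ∈ closure (range j) := hj.dense e
    rw [hcl.closure_eq] at this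
    obtain ⟨q, hq⟩ := this
    exact hje q hq
  have hsurj : Function.Surjective π := by
    intro y
    by_cases hy : y ∈ range j
    · obtain ⟨q, rfl⟩ := hy
      exact ⟨q, hπQ q q.2⟩
    · obtain ⟨z, hz⟩ := hne
      have : y ∈ ({e} : Set Y) := he ▸ hy
      exact ⟨z, (hπe z hz).trans this.symm⟩
  have hYm := metrizableSpace_of_surjective hπ hsurj
  have hno := hY.not_isSimpleClosedCurve
  have hπinj : ∀ y z, y ∈ Q → π y = π z → y = z := by
    intro y z hy h
    rw [hπQ y hy] at h
    by_cases hz : z ∈ Q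
    · rw [hπQ z hz] at h
      exact congrArg Subtype.val (hj.injective h)
    · rw [hπe z hz] at h
      exact absurd h (hje _)
  -- A subarc through `Q` with only its ends off `Q` is closed up by `π` into a simple closed curve
  -- of `Y`.
  have harc : ∀ A p q, IsArc A p q → p ∉ Q → q ∉ Q → ∀ y ∈ A, y ∉ Q := by
    intro A p q hA hp hq y hyA hyQ
    obtain ⟨A', -, a, ha, b, hb, hA', -, hint⟩ := hA.exists_subarc hQ.isClosed_compl hp hq hyA
      (not_not.2 hyQ)
    obtain ⟨f, hf, hfi, rfl, rfl, rfl⟩ := hA'.exists_param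
    have hIoo : ∀ t ∈ Ioo (0 : ℝ) 1, f t ∈ Q := by
      intro t ht
      by_contra h
      rcases hint ⟨⟨t, Ioo_subset_Icc_self ht, rfl⟩, h⟩ with h | h
      · exact ht.1.ne' (hfi (Ioo_subset_Icc_self ht) (by simp) h)
      · exact ht.2.ne (hfi (Ioo_subset_Icc_self ht) (by simp) h)
    refine hno _ (isSimpleClosedCurve_of_loop (hπ.comp hf).continuousOn ?_ ?_)
    · exact (hπe _ ha).trans (hπe _ hb).symm
    · intro s hs t ht hst
      refine hfi (Ico_subset_Icc_self hs) (Ico_subset_Icc_self ht) ?_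
      rcases hs.1.eq_or_lt with rfl | hs0
      · rcases ht.1.eq_or_lt with rfl | ht0
        · rfl
        · exact (hπinj _ _ (hIoo t ⟨ht0, ht.2⟩) hst.symm).symm
      · exact hπinj _ _ (hIoo s ⟨hs0, hs.2⟩) hst
  -- Two points of the curve off `Q` reduce to the case of arcs; with at most one such point, `π`
  -- embeds the curve in `Y`.
  have hcurve : ∀ S : Set X, IsSimpleClosedCurve S → ∀ c ∈ S, c ∉ Q := by
    intro S hS c hc hcQ
    by_cases hpq : ∃ p ∈ S, ∃ q ∈ S, p ∉ Q ∧ q ∉ Q ∧ p ≠ q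
    · obtain ⟨p, hp, q, hq, hpQ, hqQ, hne⟩ := hpq
      obtain ⟨A, -, hA, hcA⟩ := hS.exists_isArc hp hq hc hne
      exact harc A p q hA hpQ hqQ c hcA hcQ
    · push Not at hpq
      obtain ⟨E⟩ := hS
      have hcont : Continuous fun z => π (E z) :=
        hπ.comp (continuous_subtype_val.comp E.continuous)
      have hinj : Function.Injective fun z => π (E z) := by
        intro z w h
        refine E.injective (Subtype.ext ?_)
        by_cases hz : (E z : X) ∈ Q
        · exact hπinj _ _ hz h
        · by_cases hw : (E w : X) ∈ Q
          · exact (hπinj _ _ hw h.symm).symm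
          · exact hpq _ (E z).2 _ (E w).2 hz hw
      exact hno _ ⟨(hcont.isClosedEmbedding hinj).isEmbedding.toHomeomorph⟩
  rintro ⟨A, a, b, hA, ⟨S, hS, haS⟩, ⟨T, hT, hbT⟩, hxA⟩
  exact harc A a b hA (hcurve S hS a haS) (hcurve T hT b hbT) x hxA hxQ

end NoCurves

/-! ### Comparison of the three descriptions -/

section Skeleton

variable {X : Type u} [TopologicalSpace X]

theorem isClosed_berkovichSkeleton : IsClosed (berkovichSkeleton X) := by
  refine IsOpen.isClosed_compl (isOpen_iff_mem_nhds.2 ?_)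
  rintro x ⟨Q, hQ, hx, h⟩
  exact mem_of_superset (hQ.mem_nhds hx) fun y hy => ⟨Q, hQ, hy, h⟩

theorem IsDendrite.curveHull_eq_empty (hX : IsDendrite X) : curveHull X = ∅ := by
  refine eq_empty_of_forall_notMem ?_
  rintro x ⟨-, -, -, -, ⟨S, hS, -⟩, -⟩
  exact hX.noCurve S hS

/-- Nontriviality provides the attaching point when `X` is a dendrite: any other point works, as
there are no curves to avoid. -/
theorem IsLocalDendrite.curveHull_eq_berkovichSkeleton (hX : IsLocalDendrite X) [Nontrivial X] :
    curveHull X = berkovichSkeleton X := by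
  have := hX.continuum.metrizable
  have := hX.continuum.compact
  have := hX.continuum.connected
  have := hX.locallyConnectedSpace
  apply subset_antisymm
  · rintro x hx ⟨Q, hQ, hxQ, -, hend⟩
    exact notMem_curveHull_of_hasSingleEndpoint hQ hend hxQ hx
  · intro x hx
    by_contra hcon
    by_cases hD : IsDendrite X
    · obtain ⟨e, he⟩ := exists_ne x
      exact notMem_berkovichSkeleton_of_branch he.symm (fun S _ => hD.noCurve S) hx
    · obtain ⟨e, he, hno⟩ := hX.exists_branch hD hcon
      exact notMem_berkovichSkeleton_of_branch he hno hx

/-- Closedness is read off from the skeleton, whose complement is a union of open sets. -/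
theorem IsLocalDendrite.isClosed_curveHull (hX : IsLocalDendrite X) : IsClosed (curveHull X) := by
  rcases subsingleton_or_nontrivial X with h | h
  · have := Subsingleton.discreteTopology (α := X)
    exact isClosed_discrete _
  · rw [hX.curveHull_eq_berkovichSkeleton]
    exact isClosed_berkovichSkeleton

theorem IsLocalDendrite.isPreconnected_curveHull (hX : IsLocalDendrite X) :
    IsPreconnected (curveHull X) := by
  have := hX.continuum.metrizable
  have := hX.continuum.compact
  have := hX.continuum.connected
  have := hX.locallyConnectedSpace
  refine isPreconnected_of_forall_pair ?_
  rintro x ⟨A, a, b, hA, haS, hbT, hxA⟩ y ⟨A', a', b', hA', haS', hbT', hyA'⟩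
  have h1 : A ⊆ curveHull X := fun z hz => ⟨A, a, b, hA, haS, hbT, hz⟩
  have h2 : A' ⊆ curveHull X := fun z hz => ⟨A', a', b', hA', haS', hbT', hz⟩
  rcases eq_or_ne a a' with rfl | haa'
  · exact ⟨A ∪ A', union_subset h1 h2, .inl hxA, .inr hyA',
      hA.isPreconnected.union a hA.left_mem hA'.left_mem hA'.isPreconnected⟩
  -- Any arc joining endpoints `a` and `a'` that lie on curves belongs to the hull by definition.
  · obtain ⟨B, -, hB⟩ := exists_isArc_of_isOpen isOpen_univ isPreconnected_univ (mem_univ a)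
      (mem_univ a') haa'
    have h3 : B ⊆ curveHull X := fun z hz => ⟨B, a, a', hB, haS, haS', hz⟩
    exact ⟨A ∪ B ∪ A', union_subset (union_subset h1 h3) h2, .inl (.inl hxA), .inr hyA',
      (hA.isPreconnected.union a hA.left_mem hB.left_mem hB.isPreconnected).union a'
        (.inr hB.right_mem) hA'.left_mem hA'.isPreconnected⟩

/-- By the cycle lemma, a hull point outside `G` would lie on a simple closed curve, and all of
these are in `G`. -/
theorem IsLocalDendrite.curveHull_subset (hX : IsLocalDendrite X) {G : Set X}
    (hG : IsPreconnected G) (hS : ∀ S : Set X, IsSimpleClosedCurve S → S ⊆ G) :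
    curveHull X ⊆ G := by
  have := hX.continuum.metrizable
  have := hX.continuum.compact
  have := hX.locallyConnectedSpace
  rintro x ⟨A, a, b, hA, ⟨S, hSc, haS⟩, ⟨T, hTc, hbT⟩, hxA⟩
  by_contra hxG
  obtain ⟨R, hR, hxR⟩ := hA.exists_isSimpleClosedCurve_of_isPreconnected hG (hS S hSc haS)
    (hS T hTc hbT) hxA hxG
  exact hxG (hS R hR hxR)

theorem IsLocalDendrite.isLeast_curveHull (hX : IsLocalDendrite X) (hD : ¬ IsDendrite X) :
    IsLeast {G : Set X | IsContinuum G ∧ ∀ S : Set X, IsSimpleClosedCurve S → S ⊆ G}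
      (curveHull X) := by
  have := hX.continuum.metrizable
  have := hX.continuum.compact
  obtain ⟨S, hS⟩ : ∃ S : Set X, IsSimpleClosedCurve S := by
    by_contra! h
    exact hD ⟨hX.continuum, hX.locallyConnectedSpace, h⟩
  obtain ⟨a, ha⟩ := hS.nonempty
  refine ⟨⟨⟨isCompact_iff_compactSpace.1 hX.isClosed_curveHull.isCompact,
    isConnected_iff_connectedSpace.1 ⟨⟨a, hS.subset_curveHull ha⟩, hX.isPreconnected_curveHull⟩,
    inferInstance⟩, fun T hT => hT.subset_curveHull⟩, ?_⟩
  rintro G ⟨hG, hSG⟩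
  exact hX.curveHull_subset (isConnected_iff_connectedSpace.2 hG.connected).isPreconnected hSG

end Skeleton

theorem proposition7 {X : Type u} [TopologicalSpace X] (hX : IsLocalDendrite X) :
    ∃ Δ : Set X, IsClosed Δ ∧
      (IsDendrite X → Δ = ∅) ∧
      (¬ IsDendrite X →
        IsLeast {G : Set X | IsContinuum G ∧ ∀ S : Set X, IsSimpleClosedCurve S → S ⊆ G} Δ) ∧
      Δ = {x : X | ∃ (A : Set X) (a b : X), IsArc A a b ∧
        (∃ S : Set X, IsSimpleClosedCurve S ∧ a ∈ S) ∧
        (∃ T : Set X, IsSimpleClosedCurve T ∧ b ∈ T) ∧ x ∈ A} ∧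
      (Nontrivial X → Δ = berkovichSkeleton X) :=
  ⟨curveHull X, hX.isClosed_curveHull, fun hD => hD.curveHull_eq_empty, hX.isLeast_curveHull, rfl,
    fun _ => hX.curveHull_eq_berkovichSkeleton⟩
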